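/- Let $p$ be a prime and let $K$ be a local field of characteristic $p$, i.e. a field complete with respect to a normalized discrete valuation $v_K$, with perfect residue field $\mathbb F$; thus $K\cong\mathbb F((t))$, and we regard $\mathbb F$ as a subfield of $K$. Let $L/K$ be a totally ramified Galois extension with group $G\cong C_p^n$, let $v_L$ be the normalized valuation of $L$, and assume that $L/K$ has a single (lower) ramification break $b$, with $b>0$. *Artin–Schreier data* for $L/K$ is a triple $(\beta,\vec\omega,\vec\epsilon)$ with $\beta\in K$, $v_K(\beta)=-b$, $\omega_1,\dots,\omega_n\in\mathbb F$, and $\epsilon_1,\dots,\epsilon_n\in K$ such that $v_K(\epsilon_i)>-b$, such that for each $i$ either $v_K(\epsilon_i)<0$ and $p\nmid v_K(\epsilon_i)$, or $\epsilon_i\in\mathbb F$, and such that $L=K(x_1,\dots,x_n)$ where $x_i^p-x_i=\omega_i^{p^n}\beta+\epsilon_i$. Let $R=\mathbb F[G]$, acting on $L$, with augmentation ideal $A$. For $\gamma\in R$ set $$\hat v_L(\gamma)=\min\{v_L(\gamma(x))-v_L(x): x\in L^\times\}\in\mathbb Z\cup\{\infty\}.$$ An element $\rho\in L^\times$ is a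 *valuation criterion element* if $v_L(\rho)\equiv -d_{L/K}-1\pmod{p^n}$, where $\mathcal M_L^{d_{L/K}}$ is the different of $L/K$. For $2\le k\le p$, the group $(1+A)/(1+A^k)$, identified with its image in $(R/A^k)^\times$, is an $\mathbb F$-vector space with scalar multiplication given by truncated powers $\omega\cdot\bar\gamma=\bar\gamma^{[\omega]}=\sum_{i=0}^{p-1}\binom{\omega}{i}(\bar\gamma-1)^i$. Let $\overline G^{[\mathbb F]}$ be the $\mathbb F$-span of the image of $G$ in it. For a valuation criterion element $\rho$ let $$B_{\rho,k}=\Bigl\{\max_{\gamma'\in\bar\gamma}v_L((\gamma'-1)(\rho))-v_L(\rho) : \bar\gamma\in\overline G^{[\mathbb F]},\ \bar\gamma\ne\bar 1\Bigr\},$$ where $\bar\gamma$ is regarded as a coset of $A^k$ in $R$. If $B_{\rho,k}$ is the same for all valuation criterion elements $\rho$, the $VC_k$-refined breaks of $L/K$ are said to be defined and are the elements of this common set. For $\bar\gamma\in R/A^k$ let $\hat v_L(\bar\gamma)=\max\{\hat v_L(\gamma'):\gamma'\in\bar\gamma\}$, and for $h\ge0$ let $\overline G^{[\mathbb F]}_h=\{\bar\gamma\in\overline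 G^{[\mathbb F]}:\hat v_L(\bar\gamma-\bar1)\ge h\}$. The $SS_k$-refined breaks of $L/K$ are the integers $h\ge0$ such that $\overline G^{[\mathbb F]}_{h+1}\ne\overline G^{[\mathbb F]}_h$. **Theorem.** Assume that there is Artin–Schreier data $(\beta,\vec\omega,\vec\epsilon)$ for $L/K$ such that $v_K(\epsilon_i)>-b/p^{n-2}$ for $1\le i\le n$. Then: 1. For every valuation criterion element $\rho$ for $L/K$ and every $\Upsilon\in A\smallsetminus A^2$ we have $\hat v_L(\Upsilon)=v_L(\Upsilon(\rho))-v_L(\rho)$. 2. For every $k$ with $2\le k\le p$, the $VC_k$-refined breaks of $L/K$ are defined, and the set of $VC_k$-refined breaks of $L/K$ is equal to the set of $SS_k$-refined breaks of $L/K$. -/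

import Mathlib

open scoped Nat

noncomputable section

namespace RefinedBreaks

/-- Completeness of a field for an additive valuation: Cauchy sequences converge. -/
def IsCompleteFor {K : Type*} [Field K] (v : AddValuation K (WithTop ℤ)) : Prop :=
  ∀ a : ℕ → K,
    (∀ N : ℤ, ∃ M : ℕ, ∀ i ≥ M, ∀ j ≥ M, (N : WithTop ℤ) ≤ v (a i - a j)) →
    ∃ x : K, ∀ N : ℤ, ∃ M : ℕ, ∀ i ≥ M, (N : WithTop ℤ) ≤ v (a i - x)

/-- `K` is a local field (complete, discretely valued) with normalized valuation `v`, and the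
subfield `F` of `K` maps isomorphically onto its residue field. -/
structure IsLocalField (F : Type*) {K : Type*} [Field F] [Field K] [Algebra F K]
    (v : AddValuation K (WithTop ℤ)) : Prop where
  normalized : Function.Surjective v
  complete : IsCompleteFor v
  coeff_unit : ∀ c : F, c ≠ 0 → v (algebraMap F K c) = 0
  coeff_residue : ∀ x : K, 0 ≤ v x → ∃ c : F, 0 < v (x - algebraMap F K c)

/-- `L/K` is totally ramified, `vL` being the normalized valuation of `L` that extends `vK`:
the ramification index equals the degree. -/
structure IsTotallyRamified {K L : Type*} [Field K] [Field L] [Algebra K L]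
    (vK : AddValuation K (WithTop ℤ)) (vL : AddValuation L (WithTop ℤ)) : Prop where
  normalized : Function.Surjective vL
  extends_vK : ∀ x : K, vL (algebraMap K L x) = Module.finrank K L • vK x

section Ramification

variable {K L : Type*} [Field K] [Field L] [Algebra K L]

/-- The lower ramification group `G_i`. -/
def ramificationGroup (K : Type*) {L : Type*} [Field K] [Field L] [Algebra K L]
    (vL : AddValuation L (WithTop ℤ)) (i : ℤ) : Set (L ≃ₐ[K] L) :=
  {σ | ∀ x : L, 0 ≤ vL x → ((i + 1 : ℤ) : WithTop ℤ) ≤ vL (σ x - x)}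

/-- The set of lower ramification breaks of `L/K`. -/
def ramificationBreaks (K : Type*) {L : Type*} [Field K] [Field L] [Algebra K L]
    (vL : AddValuation L (WithTop ℤ)) : Set ℤ :=
  {i | -1 ≤ i ∧ ramificationGroup K vL i ≠ ramificationGroup K vL (i + 1)}

/-- The different of `L/K` is the `d`-th power of the maximal ideal of `L`: the dual of the ring
of integers of `L` for the trace form is `{x | -d ≤ vL x}`. -/
def IsDifferentExponent (vK : AddValuation K (WithTop ℤ)) (vL : AddValuation L (WithTop ℤ))
    (d : ℤ) : Prop :=
  ∀ x : L, (∀ y : L, 0 ≤ vL y → 0 ≤ vK (Algebra.trace K L (x * y))) ↔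
    ((-d : ℤ) : WithTop ℤ) ≤ vL x

/-- Valuation criterion elements: `ρ ≠ 0` and `vL ρ ≡ -d - 1` modulo `[L : K]`, where `d` is the
exponent of the different. -/
def IsValuationCriterion (vK : AddValuation K (WithTop ℤ)) (vL : AddValuation L (WithTop ℤ))
    (ρ : L) : Prop :=
  ∃ d m : ℤ, IsDifferentExponent vK vL d ∧ vL ρ = (m : WithTop ℤ) ∧
    m ≡ -d - 1 [ZMOD (Module.finrank K L : ℤ)]

end Ramification

/-- Artin-Schreier data `(β, ω, ε)` for the `C_p^n`-extension `L/K` with single break `b`. -/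
structure IsArtinSchreierData {F K : Type*} (L : Type*) [Field F] [Field K] [Field L]
    [Algebra F K] [Algebra K L] (vK : AddValuation K (WithTop ℤ)) (p n : ℕ) (b : ℤ)
    (β : K) (ω : Fin n → F) (ε : Fin n → K) : Prop where
  val_beta : vK β = ((-b : ℤ) : WithTop ℤ)
  val_eps : ∀ i, ((-b : ℤ) : WithTop ℤ) < vK (ε i)
  reduced : ∀ i, (∃ m : ℤ, vK (ε i) = (m : WithTop ℤ) ∧ m < 0 ∧ ¬ (p : ℤ) ∣ m) ∨
    ε i ∈ Set.range (algebraMap F K)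
  generates : ∃ x : Fin n → L,
    (∀ i, x i ^ p - x i = algebraMap K L (algebraMap F K (ω i) ^ p ^ n * β + ε i)) ∧
    IntermediateField.adjoin K (Set.range x) = ⊤

section GroupRing

variable (F K L : Type*) [Field F] [Field K] [Field L] [Algebra F K] [Algebra K L]

/-- The group ring `R = F[G]` of `G = Gal(L/K)`. -/
abbrev GroupRing : Type _ := MonoidAlgebra F (L ≃ₐ[K] L)

/-- The augmentation ideal `A` of `R`. -/
abbrev augIdeal : Ideal (GroupRing F K L) :=
  RingHom.ker (MonoidAlgebra.lift F F (L ≃ₐ[K] L) (1 : (L ≃ₐ[K] L) →* F))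

/-- The ring `R / A^k`. -/
abbrev QuotRing (k : ℕ) : Type _ := GroupRing F K L ⧸ (augIdeal F K L ^ k)

variable {F K L}

/-- The action of `γ ∈ F[G]` on `L`, where `F ⊆ K ⊆ L`. -/
def act (γ : GroupRing F K L) (x : L) : L :=
  γ.coeff.sum fun σ c => algebraMap K L (algebraMap F K c) * σ x

/-- `vL (γ x) - vL x`, used for `x ≠ 0`; it is `⊤` exactly when `γ x = 0`. -/
def shift (vL : AddValuation L (WithTop ℤ)) (γ : GroupRing F K L) (x : L) : WithTop ℤ :=
  vL (act γ x) - vL x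

/-- The set of all shifts of valuation effected by `γ` on `L ∖ {0}`. -/
def shiftSet (vL : AddValuation L (WithTop ℤ)) (γ : GroupRing F K L) : Set (WithTop ℤ) :=
  {s | ∃ x : L, x ≠ 0 ∧ s = shift vL γ x}

/-- The smallest shift: the minimum of `vL (γ x) - vL x` over `x ≠ 0`. -/
def vHat (vL : AddValuation L (WithTop ℤ)) (γ : GroupRing F K L) : WithTop ℤ :=
  sInf (shiftSet vL γ)

/-- The maximum of `vHat γ'` over `γ'` in the coset `c` of `A^k`. -/
def vHatBar (vL : AddValuation L (WithTop ℤ)) {k : ℕ} (c : QuotRing F K L k) : WithTop ℤ :=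
  sSup {s | ∃ γ : GroupRing F K L, Ideal.Quotient.mk (augIdeal F K L ^ k) γ = c ∧ s = vHat vL γ}

/-- The binomial coefficient `ω (ω - 1) ⋯ (ω - (i - 1)) / i!` for `ω ∈ F`
(used for `i < p` only, where `i!` is invertible). -/
def binom {F : Type*} [Field F] (ω : F) (i : ℕ) : F :=
  (∏ j ∈ Finset.range i, (ω - (j : F))) / ((i ! : ℕ) : F)

/-- The truncated power `y^[ω] = (1 + (y - 1))^[ω] = ∑_{i < p} binom(ω, i) (y - 1)^i`. -/
def truncPow {F S : Type*} [Field F] [Ring S] [Algebra F S] (p : ℕ) (y : S) (ω : F) : S :=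
  ∑ i ∈ Finset.range p, binom ω i • (y - 1) ^ i

/-- The `F`-span of the image of `G` in the `F`-vector space `(1 + A)/(1 + A^k)`, viewed in
`R / A^k`. Addition in this vector space is multiplication in `R / A^k` and scalar multiplication
is the truncated power, so the span is the smallest set which contains the image of `G` and is
closed under these two operations. -/
inductive GSpan (p k : ℕ) : QuotRing F K L k → Prop
  | of (σ : L ≃ₐ[K] L) :
      GSpan p k (Ideal.Quotient.mk (augIdeal F K L ^ k) (MonoidAlgebra.of F (L ≃ₐ[K] L) σ))
  | add {c d : QuotRing F K L k} : GSpan p k c → GSpan p k d → GSpan p k (c * d)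
  | smul (ω : F) {c : QuotRing F K L k} : GSpan p k c → GSpan p k (truncPow p c ω)

/-- `i_ρ(c)`, the maximum of `vL ((γ - 1) ρ)` over `γ` in the coset `c` of `A^k`. -/
def iRho (vL : AddValuation L (WithTop ℤ)) (ρ : L) {k : ℕ} (c : QuotRing F K L k) : WithTop ℤ :=
  sSup {s | ∃ γ : GroupRing F K L, Ideal.Quotient.mk (augIdeal F K L ^ k) γ = c ∧
    s = vL (act (γ - 1) ρ)}

variable (F K)

/-- The set `B_{ρ,k}` of `(ρ,k)`-refined breaks. -/
def rhoBreaks (vL : AddValuation L (WithTop ℤ)) (p k : ℕ) (ρ : L) : Set (WithTop ℤ) :=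
  {h | ∃ c : QuotRing F K L k, GSpan p k c ∧ c ≠ 1 ∧ h = iRho vL ρ c - vL ρ}

/-- The `VC_k`-refined breaks are defined: `B_{ρ,k}` does not depend on the valuation criterion
element `ρ`. -/
def VCBreaksDefined (vK : AddValuation K (WithTop ℤ)) (vL : AddValuation L (WithTop ℤ))
    (p k : ℕ) : Prop :=
  ∀ ρ ρ' : L, IsValuationCriterion vK vL ρ → IsValuationCriterion vK vL ρ' →
    rhoBreaks F K vL p k ρ = rhoBreaks F K vL p k ρ'

/-- The set of `VC_k`-refined breaks: the common value of the `B_{ρ,k}`, if they all agree. -/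
def vcBreaks (vK : AddValuation K (WithTop ℤ)) (vL : AddValuation L (WithTop ℤ))
    (p k : ℕ) : Set (WithTop ℤ) :=
  {h | ∃ ρ : L, IsValuationCriterion vK vL ρ ∧ h ∈ rhoBreaks F K vL p k ρ}

/-- The set `G_h^[F]` of all `c` in the span of `G` with `c - 1 ∈ J_h`. -/
def spanFiltration (vL : AddValuation L (WithTop ℤ)) (p k h : ℕ) : Set (QuotRing F K L k) :=
  {c | GSpan p k c ∧ ((h : ℤ) : WithTop ℤ) ≤ vHatBar vL (c - 1)}

/-- The set of `SS_k`-refined breaks: the integers `h ≥ 0` with `G_{h+1}^[F] ≠ G_h^[F]`. -/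
def ssBreaks (vL : AddValuation L (WithTop ℤ)) (p k : ℕ) : Set (WithTop ℤ) :=
  {s | ∃ h : ℕ, s = ((h : ℤ) : WithTop ℤ) ∧
    spanFiltration F K vL p k (h + 1) ≠ spanFiltration F K vL p k h}

end GroupRing

end RefinedBreaks

end

open scoped Nat

noncomputable section

namespace RefinedBreaks

/-! ### Additive valuations with values in the integers and infinity. -/

section Valuation

variable {L : Type*} [Field L] (v : AddValuation L (WithTop ℤ))

/-! Write `N = p ^ n`. Everything rests on one element `Y` of valuation `-b`, prime to `p`, with two
properties: `σ Y - Y` is a constant of `F` up to positive valuation, nonzero for `σ ≠ 1`, and all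
these differences lie in one subfield of degree `p` over `K`, where valuations are multiples of `p ^
(n - 1)`.

Construction (`exists_scaffold`): put `Y = ∑ c i * x i - f`. Since `x i ^ N = x i + ∑_{m < n} z i ^
p ^ m`, coefficients `c` dual to the Moore matrix of `ω` cancel the large poles of `Y ^ N`, leaving
a main term of valuation `-b * N`. Of the remaining error terms only the one with `m = n - 1` can be
too large; it is cancelled by `f ^ N`, where `f` is an approximate `p`-th root in `K(x₀)` that the
Galois group almost fixes. The hypothesis on the `ε i` is what makes such an `f` available
(`exists_approx_root`).

Shifts (`IsScaffold.exists_shift`): for `γ` in `A`, the binomial theorem gives `γ (Y ^ i) = Y ^ i *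
∑ binom(i, k) * d k` with `d k = (∑ γ_σ (σ Y - Y) ^ k) / Y ^ k` and `d 0 = 0`. The valuation of `d
k` is `b * k` plus a nonnegative multiple of `p ^ (n - 1)`. If `γ` is not in `A ^ 2`, some `d (p ^
j)` has valuation exactly `b * p ^ j`, so the minimum `S` is at most `b * p ^ (n - 1)`, and this
forces it to be attained once. Every element is shifted by at least `S`. For `i = N - 1` all
binomial coefficients are `±1`, so the shift is exactly `S` on valuations congruent to `-b * (N -
1)`, that is to `b`. By `IsScaffold.isDifferentExponent` these are the valuations of valuation
criterion elements; this is the first claim.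

For the second claim, `GSpan.sub_one_mem` shows that a nontrivial class of the span differs from `1`
only by elements of `A` outside `A ^ 2`. The first claim then equates, representative by
representative, the quantities maximized in the two definitions of refined breaks. -/

lemma exists_val_eq {x : L} (hx : x ≠ 0) : ∃ m : ℤ, v x = (m : WithTop ℤ) :=
  ⟨_, (WithTop.coe_untop _ ((v.ne_top_iff).2 hx)).symm⟩

variable {v}

lemma ne_zero_of_val {x : L} {m : ℤ} (h : v x = (m : WithTop ℤ)) : x ≠ 0 := by
  rintro rfl
  simp at h

lemma lt_iff_add_one_le {a : WithTop ℤ} {m : ℤ} :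
    ((m : ℤ) : WithTop ℤ) < a ↔ ((m + 1 : ℤ) : WithTop ℤ) ≤ a := by
  induction a with
  | top => simp [WithTop.coe_lt_top]
  | coe a => norm_cast

lemma val_mul_eq {x y : L} {m k : ℤ} (hx : v x = (m : WithTop ℤ)) (hy : v y = (k : WithTop ℤ)) :
    v (x * y) = ((m + k : ℤ) : WithTop ℤ) := by
  rw [v.map_mul, hx, hy]; rfl

lemma val_pow_eq {x : L} {m : ℤ} (hx : v x = (m : WithTop ℤ)) (k : ℕ) :
    v (x ^ k) = ((k * m : ℤ) : WithTop ℤ) := by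
  rw [v.map_pow, hx, ← WithTop.coe_nsmul, nsmul_eq_mul]

lemma val_inv_eq {x : L} {m : ℤ} (hx : v x = (m : WithTop ℤ)) :
    v x⁻¹ = ((-m : ℤ) : WithTop ℤ) := by
  rw [v.map_inv, hx]; rfl

lemma val_div_eq {x y : L} {m k : ℤ} (hx : v x = (m : WithTop ℤ)) (hy : v y = (k : WithTop ℤ)) :
    v (x / y) = ((m - k : ℤ) : WithTop ℤ) := by
  rw [div_eq_mul_inv, val_mul_eq hx (val_inv_eq hy), sub_eq_add_neg]

lemma le_val_mul {x y : L} {m k : ℤ} (hx : (m : WithTop ℤ) ≤ v x) (hy : (k : WithTop ℤ) ≤ v y) :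
    ((m + k : ℤ) : WithTop ℤ) ≤ v (x * y) := by
  rw [v.map_mul, WithTop.coe_add]
  exact add_le_add hx hy

lemma le_val_pow {x : L} {m : ℤ} (hx : (m : WithTop ℤ) ≤ v x) (k : ℕ) :
    ((k * m : ℤ) : WithTop ℤ) ≤ v (x ^ k) := by
  induction k with
  | zero => simp
  | succ k ih =>
    rw [pow_succ]
    convert le_val_mul ih hx using 2
    push_cast; ring

lemma val_eq_of_pow_eq {x : L} {m : ℤ} {k : ℕ} (hk : 0 < k)
    (h : v (x ^ k) = ((k * m : ℤ) : WithTop ℤ)) : v x = (m : WithTop ℤ) := by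
  have hx : x ≠ 0 := by
    rintro rfl
    rw [zero_pow hk.ne', v.map_zero] at h
    exact WithTop.top_ne_coe h
  obtain ⟨r, hr⟩ := exists_val_eq v hx
  rw [val_pow_eq hr, WithTop.coe_inj] at h
  rw [hr, WithTop.coe_inj]
  exact mul_left_cancel₀ (by exact_mod_cast hk.ne') h

lemma coe_le_of_le {a : WithTop ℤ} {m k : ℤ} (h : (m : WithTop ℤ) ≤ a) (hk : k ≤ m) :
    (k : WithTop ℤ) ≤ a :=
  le_trans (WithTop.coe_le_coe.2 hk) h

lemma coe_lt_of_le {a : WithTop ℤ} {m k : ℤ} (h : (m : WithTop ℤ) ≤ a) (hk : k < m) :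
    (k : WithTop ℤ) < a :=
  lt_of_lt_of_le (WithTop.coe_lt_coe.2 hk) h

lemma val_add_eq_left {x y : L} {m : ℤ} (hx : v x = (m : WithTop ℤ))
    (hy : (m : WithTop ℤ) < v y) : v (x + y) = (m : WithTop ℤ) := by
  rw [v.map_add_eq_of_lt_left (by rwa [hx]), hx]

lemma val_natCast_nonneg (k : ℕ) : ((0 : ℤ) : WithTop ℤ) ≤ v (k : L) := by
  induction k with
  | zero => simp
  | succ k ih =>
    push_cast
    exact v.map_le_add ih (by simp)

lemma lt_val_sum {ι : Type*} {s : Finset ι} {f : ι → L} {m : ℤ}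
    (h : ∀ i ∈ s, (m : WithTop ℤ) < v (f i)) : (m : WithTop ℤ) < v (∑ i ∈ s, f i) := by
  simp only [lt_iff_add_one_le] at h ⊢
  exact v.map_le_sum h

lemma val_sum_eq_of_lt {ι : Type*} {s : Finset ι} {f : ι → L} {i : ι} (hi : i ∈ s) {m : ℤ}
    (hm : v (f i) = (m : WithTop ℤ)) (h : ∀ j ∈ s, j ≠ i → (m : WithTop ℤ) < v (f j)) :
    v (∑ j ∈ s, f j) = (m : WithTop ℤ) := by
  classical
  rw [← Finset.add_sum_erase s f hi]
  refine val_add_eq_left hm (lt_val_sum fun j hj => ?_)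
  exact h j (Finset.mem_of_mem_erase hj) (Finset.ne_of_mem_erase hj)

lemma val_prod_eq {ι : Type*} {s : Finset ι} {f : ι → L} {m : ℤ}
    (h : ∀ i ∈ s, v (f i) = (m : WithTop ℤ)) :
    v (∏ i ∈ s, f i) = ((s.card * m : ℤ) : WithTop ℤ) := by
  classical
  induction s using Finset.induction_on with
  | empty => simp
  | insert a s ha ih =>
    rw [Finset.prod_insert ha, val_mul_eq (h a (by simp)) (ih fun i hi => h i (by simp [hi])),
      Finset.card_insert_of_notMem ha]
    congr 1; push_cast; ring

/-- The valuation of a sum of terms whose valuations are pairwise distinct is the valuation of one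
of the terms, and no term has a smaller valuation. -/
lemma val_sum_eq_min {ι : Type*} {s : Finset ι} {f : ι → L} (hs : ∑ i ∈ s, f i ≠ 0)
    (h : ∀ i ∈ s, ∀ j ∈ s, v (f i) = v (f j) → f i ≠ 0 → i = j) :
    ∃ i ∈ s, v (∑ i ∈ s, f i) = v (f i) ∧ ∀ j ∈ s, v (f i) ≤ v (f j) := by
  have hne : s.Nonempty := by
    by_contra hne
    simp [Finset.not_nonempty_iff_eq_empty.1 hne] at hs
  obtain ⟨i, hi, hmin⟩ := s.exists_min_image (fun i => v (f i)) hne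
  refine ⟨i, hi, ?_, hmin⟩
  have h0 : f i ≠ 0 := by
    intro h0
    refine hs (Finset.sum_eq_zero fun j hj => ?_)
    have := hmin j hj
    simpa [h0] using this
  obtain ⟨m, hm⟩ := exists_val_eq v h0
  rw [hm]
  refine val_sum_eq_of_lt hi hm fun j hj hji => ?_
  rw [← hm]
  exact lt_of_le_of_ne (hmin j hj) fun he => hji (h i hi j hj he h0).symm

end Valuation

/-! ### Bases with distinct valuations in totally ramified extensions. -/

section TotallyRamified

variable {K L : Type*} [Field K] [Field L] [Algebra K L] [FiniteDimensional K L]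
  {vK : AddValuation K (WithTop ℤ)} {vL : AddValuation L (WithTop ℤ)}
  (hL : IsTotallyRamified vK vL)

include hL

lemma val_algebraMap {a : K} {m : ℤ} (h : vK a = (m : WithTop ℤ)) :
    vL (algebraMap K L a) = ((Module.finrank K L * m : ℤ) : WithTop ℤ) := by
  rw [hL.extends_vK, h, ← WithTop.coe_nsmul, nsmul_eq_mul]

lemma le_val_algebraMap {a : K} {m : ℤ} (h : (m : WithTop ℤ) ≤ vK a) :
    ((Module.finrank K L * m : ℤ) : WithTop ℤ) ≤ vL (algebraMap K L a) := by
  rcases eq_or_ne a 0 with rfl | ha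
  · simp
  obtain ⟨r, hr⟩ := exists_val_eq vK ha
  rw [val_algebraMap hL hr, WithTop.coe_le_coe]
  rw [hr, WithTop.coe_le_coe] at h
  exact mul_le_mul_of_nonneg_left h (by positivity)

lemma le_val_of_le_val_algebraMap {a : K} {m : ℤ}
    (h : ((Module.finrank K L * (m - 1) : ℤ) : WithTop ℤ) < vL (algebraMap K L a)) :
    (m : WithTop ℤ) ≤ vK a := by
  rcases eq_or_ne a 0 with rfl | ha
  · simp
  obtain ⟨r, hr⟩ := exists_val_eq vK ha
  rw [val_algebraMap hL hr, WithTop.coe_lt_coe] at h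
  rw [hr, WithTop.coe_le_coe]
  have := lt_of_mul_lt_mul_left h (by positivity)
  omega

/-- Elements of `L` in number `[L : K]` with valuations distinct modulo `[L : K]` form a basis, and
the valuation of a linear combination is the least valuation of its terms. -/
lemma exists_expansion {ι : Type*} [Fintype ι] (hι : Fintype.card ι = Module.finrank K L)
    {z : ι → L} {r : ι → ℤ} (hz : ∀ i, vL (z i) = (r i : WithTop ℤ))
    (hr : ∀ i j, r i ≡ r j [ZMOD Module.finrank K L] → i = j) (x : L) :
    ∃ a : ι → K, x = ∑ i, a i • z i ∧ (∀ i, vL x ≤ vL (a i • z i)) ∧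
      ∀ m : ℤ, vL x = (m : WithTop ℤ) → ∀ i,
        (r i ≡ m [ZMOD Module.finrank K L] → vL (a i • z i) = (m : WithTop ℤ)) ∧
        (¬ r i ≡ m [ZMOD Module.finrank K L] → (m : WithTop ℤ) < vL (a i • z i)) := by
  classical
  have hval : ∀ (a : ι → K) i, a i ≠ 0 → ∃ m : ℤ, vL (a i • z i) = (m : WithTop ℤ) ∧
      r i ≡ m [ZMOD Module.finrank K L] := by
    intro a i ha
    obtain ⟨m, hm⟩ := exists_val_eq vK ha
    refine ⟨Module.finrank K L * m + r i, ?_, ?_⟩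
    · rw [Algebra.smul_def, val_mul_eq (val_algebraMap hL hm) (hz i)]
    · exact (Int.modEq_iff_dvd.2 ⟨m, by ring⟩)
  have hsum : ∀ a : ι → K, ∑ i, a i • z i ≠ 0 →
      ∃ i, vL (∑ i, a i • z i) = vL (a i • z i) ∧ ∀ j, vL (a i • z i) ≤ vL (a j • z j) := by
    intro a ha
    obtain ⟨i, -, h1, h2⟩ := val_sum_eq_min (v := vL) ha (by
      intro i _ j _ hij h0
      have hi0 : a i ≠ 0 := fun h => h0 (by simp [h])
      have hj0 : a j ≠ 0 := by
        intro h
        rw [h, zero_smul, vL.map_zero, vL.top_iff] at hij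
        exact h0 hij
      obtain ⟨m, hm, hm'⟩ := hval a i hi0
      obtain ⟨k, hk, hk'⟩ := hval a j hj0
      rw [hm, hk, WithTop.coe_inj] at hij
      subst hij
      exact hr i j (hm'.trans hk'.symm))
    exact ⟨i, h1, fun j => h2 j (Finset.mem_univ j)⟩
  -- In a vanishing combination with a nonzero coefficient, the term of least valuation would be
  -- strictly dominant, because nonzero terms have valuations distinct modulo the degree; the sum
  -- would then have finite valuation.
  have hli : LinearIndependent K z := by
    rw [Fintype.linearIndependent_iff]
    intro a ha
    by_contra hne
    push Not at hne
    obtain ⟨i0, hi0⟩ := hne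
    obtain ⟨i, -, hmin⟩ := (Finset.univ : Finset ι).exists_min_image (fun i => vL (a i • z i))
      ⟨i0, Finset.mem_univ _⟩
    obtain ⟨m0, hm0, -⟩ := hval a i0 hi0
    have hi : a i ≠ 0 := by
      intro h
      have := hmin i0 (Finset.mem_univ _)
      simp [h, hm0] at this
    obtain ⟨m, hm, hm'⟩ := hval a i hi
    have : vL (∑ i, a i • z i) = (m : WithTop ℤ) := by
      refine val_sum_eq_of_lt (Finset.mem_univ i) hm fun j _ hji => ?_
      rw [← hm]
      refine lt_of_le_of_ne (hmin j (Finset.mem_univ _)) fun he => hji ?_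
      rw [hm] at he
      have hj : a j ≠ 0 := by
        intro h
        simp [h] at he
      obtain ⟨k, hk, hk'⟩ := hval a j hj
      rw [hk, WithTop.coe_inj] at he
      subst he
      exact hr j i (hk'.trans hm'.symm)
    rw [ha] at this
    simp at this
  have hspan := hli.span_eq_top_of_card_eq_finrank' hι
  have hx : x ∈ Submodule.span K (Set.range z) := hspan ▸ Submodule.mem_top
  obtain ⟨a, ha⟩ := (Submodule.mem_span_range_iff_exists_fun K).1 hx
  refine ⟨a, ha.symm, ?_, ?_⟩
  · intro i
    rcases eq_or_ne x 0 with hx0 | hx0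
    · have : a i = 0 := (Fintype.linearIndependent_iff.1 hli) a (ha.trans hx0) i
      simp [this]
    · obtain ⟨j, h1, h2⟩ := hsum a (ha ▸ hx0)
      rw [← ha, h1]
      exact h2 i
  · intro m hm i
    have hx0 : ∑ i, a i • z i ≠ 0 := by
      rw [ha]; exact ne_zero_of_val hm
    obtain ⟨j, h1, h2⟩ := hsum a hx0
    rw [ha, hm] at h1
    have hj : a j ≠ 0 := by
      intro h
      simp [h] at h1
    obtain ⟨k, hk, hk'⟩ := hval a j hj
    rw [hk, WithTop.coe_inj] at h1
    subst h1
    constructor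
    · intro hi
      have : i = j := hr i j (hi.trans hk'.symm)
      rw [this, hk]
    · intro hi
      rw [← hk]
      refine lt_of_le_of_ne (h2 i) fun he => hi ?_
      have hi0 : a i ≠ 0 := by
        intro h
        simp [h, hk] at he
      obtain ⟨l, hl, hl'⟩ := hval a i hi0
      rw [hk, hl, WithTop.coe_inj] at he
      subst he
      exact hl'

/-- A special case of `exists_expansion`: powers of an element times a constant. -/
lemma exists_power_expansion {y u : L} {s t : ℤ} (hy : vL y = (s : WithTop ℤ))
    (hs : IsCoprime s (Module.finrank K L)) (hu : vL u = (t : WithTop ℤ)) (x : L) :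
    ∃ a : Fin (Module.finrank K L) → K, x = ∑ i, a i • (y ^ (i : ℕ) * u) ∧
      (∀ i, vL x ≤ vL (a i • (y ^ (i : ℕ) * u))) ∧
      ∀ m : ℤ, vL x = (m : WithTop ℤ) → ∀ i : Fin (Module.finrank K L),
        ((i : ℤ) * s + t ≡ m [ZMOD Module.finrank K L] →
          vL (a i • (y ^ (i : ℕ) * u)) = (m : WithTop ℤ)) ∧
        (¬ (i : ℤ) * s + t ≡ m [ZMOD Module.finrank K L] →
          (m : WithTop ℤ) < vL (a i • (y ^ (i : ℕ) * u))) := by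
  refine exists_expansion hL (by simp) (r := fun i : Fin (Module.finrank K L) => (i : ℤ) * s + t)
    (fun i => val_mul_eq (val_pow_eq hy i) hu) (fun i j hij => ?_) x
  have h1 : ((Module.finrank K L : ℤ)) ∣ ((j : ℤ) - i) * s := by
    have := Int.modEq_iff_dvd.1 hij
    convert this using 1; ring
  have h2 := hs.symm.dvd_of_dvd_mul_right h1
  have h3 := Int.eq_zero_of_abs_lt_dvd h2 (by
    have := i.2; have := j.2
    rw [abs_lt]; constructor <;> omega)
  exact Fin.ext (by omega)

/-- Every integral element is an integral combination of the powers of a uniformizer. -/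
lemma exists_integral_expansion {π : L} (hπ : vL π = ((1 : ℤ) : WithTop ℤ)) {x : L}
    (hx : 0 ≤ vL x) :
    ∃ a : Fin (Module.finrank K L) → K, x = ∑ i, a i • π ^ (i : ℕ) ∧
      ∀ i, ((0 : ℤ) : WithTop ℤ) ≤ vK (a i) := by
  obtain ⟨a, h1, h2, -⟩ := exists_power_expansion hL hπ isCoprime_one_left
    (u := 1) (t := 0) (by simp) x
  simp only [mul_one] at h1 h2
  refine ⟨a, h1, fun i => ?_⟩
  rcases eq_or_ne (a i) 0 with h0 | h0
  · simp [h0]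
  obtain ⟨m, hm⟩ := exists_val_eq vK h0
  have := hx.trans (h2 i)
  rw [Algebra.smul_def, val_mul_eq (val_algebraMap hL hm) (val_pow_eq hπ i),
    ← WithTop.coe_zero, WithTop.coe_le_coe] at this
  rw [hm, WithTop.coe_le_coe]
  have hi : (i : ℤ) < Module.finrank K L := by exact_mod_cast i.2
  by_contra hneg
  push Not at hneg
  nlinarith

/-- The valuation of a totally ramified extension is invariant under automorphisms. -/
lemma val_algEquiv_nonneg (σ : L ≃ₐ[K] L) {x : L} (hx : 0 ≤ vL x) : 0 ≤ vL (σ x) := by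
  obtain ⟨π, hπ⟩ := hL.normalized ((1 : ℤ) : WithTop ℤ)
  by_contra hneg
  have hx0 : σ x ≠ 0 := by
    intro h
    rw [h, vL.map_zero] at hneg
    exact hneg le_top
  obtain ⟨m, hm⟩ := exists_val_eq vL hx0
  have hπ0 : σ π ≠ 0 := by simpa using ne_zero_of_val hπ
  obtain ⟨c, hc⟩ := exists_val_eq vL hπ0
  rw [hm, ← WithTop.coe_zero, WithTop.coe_le_coe, not_le] at hneg
  -- Every power of `x` is an integral combination of finitely many powers of `π`, so the valuations
  -- of `σ (x ^ k)` are bounded below independently of `k`. This is impossible if `σ x` has negative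
  -- valuation `m`.
  have key : ∀ k : ℕ, -(Module.finrank K L * |c|) ≤ k * m := by
    intro k
    have hk : 0 ≤ vL (x ^ k) := by
      rw [vL.map_pow]; exact nsmul_nonneg hx k
    obtain ⟨a, h1, h2⟩ := exists_integral_expansion hL hπ hk
    have h3 : ((-(Module.finrank K L * |c|) : ℤ) : WithTop ℤ) ≤ vL (σ (x ^ k)) := by
      rw [h1, map_sum]
      refine vL.map_le_sum fun i _ => ?_
      rw [map_smul, map_pow, Algebra.smul_def]
      refine coe_le_of_le (le_val_mul (le_val_algebraMap hL (h2 i)) (val_pow_eq hc i).ge) ?_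
      have hi : (i : ℤ) < Module.finrank K L := by exact_mod_cast i.2
      have h4 := neg_abs_le c
      have h5 := abs_nonneg c
      have h6 : (0 : ℤ) ≤ i := by positivity
      nlinarith
    rw [map_pow, val_pow_eq hm, WithTop.coe_le_coe] at h3
    exact h3
  have := key (Module.finrank K L * |c| + 1).toNat
  have h5 : (0 : ℤ) ≤ Module.finrank K L * |c| + 1 := by positivity
  rw [Int.toNat_of_nonneg h5] at this
  nlinarith

lemma val_algEquiv (hK : Function.Surjective vK) (σ : L ≃ₐ[K] L) (x : L) : vL (σ x) = vL x := by
  have key : ∀ (σ : L ≃ₐ[K] L) (x : L), vL x ≤ vL (σ x) := by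
    intro σ x
    rcases eq_or_ne x 0 with rfl | hx
    · simp
    obtain ⟨m, hm⟩ := exists_val_eq vL hx
    obtain ⟨k, hk⟩ := exists_val_eq vL ((map_ne_zero σ).2 hx)
    have hN : (0 : ℤ) < Module.finrank K L := by exact_mod_cast Module.finrank_pos
    -- The quotient of `x ^ [L : K]` by an element of `K` of the same valuation is a unit, so its
    -- image under `σ` is integral.
    have hdiv : ∀ t : K, vK t = (m : WithTop ℤ) → m ≤ k := by
      intro t ht
      have h1 := val_div_eq (val_pow_eq hm (Module.finrank K L)) (val_algebraMap hL ht)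
      rw [sub_self] at h1
      have h2 := val_algEquiv_nonneg hL σ h1.ge
      rw [map_div₀, map_pow, AlgEquiv.commutes,
        val_div_eq (val_pow_eq hk (Module.finrank K L)) (val_algebraMap hL ht),
        ← WithTop.coe_zero, WithTop.coe_le_coe] at h2
      nlinarith
    rw [hm, hk, WithTop.coe_le_coe]
    obtain ⟨t, ht⟩ := hK (m : WithTop ℤ)
    exact hdiv t ht
  refine le_antisymm ?_ (key σ x)
  simpa using key σ⁻¹ (σ x)

end TotallyRamified

/-! ### The single break, and traces of elements of given valuation. -/

section Ramification

variable {K L : Type*} [Field K] [Field L] [Algebra K L] [FiniteDimensional K L]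
  {vK : AddValuation K (WithTop ℤ)} {vL : AddValuation L (WithTop ℤ)}

/-- If `b` is the only lower ramification break, then `v (σ π - π) = b + 1` for all `σ ≠ 1` and all
uniformizers `π`. -/
lemma val_sub_of_ramificationBreaks_eq (hL : IsTotallyRamified vK vL)
    (hK : Function.Surjective vK) {b : ℤ} (hb : 0 < b) (hbreak : ramificationBreaks K vL = {b})
    {π : L} (hπ : vL π = ((1 : ℤ) : WithTop ℤ)) {σ : L ≃ₐ[K] L} (hσ : σ ≠ 1) :
    vL (π - σ π) = ((b + 1 : ℤ) : WithTop ℤ) := by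
  have hstep : ∀ i : ℤ, -1 ≤ i → i ≠ b →
      ramificationGroup K vL i = ramificationGroup K vL (i + 1) := by
    intro i hi hib
    by_contra hne
    have : i ∈ ramificationBreaks K vL := ⟨hi, hne⟩
    rw [hbreak] at this
    exact hib this
  have hlow : ∀ i : ℤ, -1 ≤ i → i ≤ b → σ ∈ ramificationGroup K vL i := by
    intro i hi
    induction i, hi using Int.leInduction with
    | base =>
      intro _ x hx
      refine vL.map_le_sub ?_ hx
      rw [val_algEquiv hL hK]
      exact hx
    | succ i hi ih =>
      intro hib
      rw [← hstep i hi (by omega)]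
      exact ih (by omega)
  have hhigh : ∀ i : ℤ, b + 1 ≤ i → σ ∈ ramificationGroup K vL (b + 1) →
      σ ∈ ramificationGroup K vL i := by
    intro i hi h
    induction i, hi using Int.leInduction with
    | base => exact h
    | succ i hi ih =>
      rw [← hstep i (by omega) (by omega)]
      exact ih
  have hint : (0 : WithTop ℤ) ≤ vL π := by
    rw [hπ]; exact_mod_cast zero_le_one
  have h1 : ((b + 1 : ℤ) : WithTop ℤ) ≤ vL (σ π - π) := hlow b (by omega) le_rfl π hint
  rw [vL.map_sub_swap]
  refine le_antisymm ?_ h1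
  by_contra hlt
  rw [not_le, lt_iff_add_one_le] at hlt
  -- Membership in a ramification group can be tested on `π` alone: `σ π - π` divides `σ (π ^ i) - π
  -- ^ i`. As there is no break after `b`, `σ` then lies in all later groups and fixes `π`.
  have hmem : σ ∈ ramificationGroup K vL (b + 1) := by
    intro x hx
    obtain ⟨a, ha, ha0⟩ := exists_integral_expansion hL hπ hx
    rw [ha, map_sum, ← Finset.sum_sub_distrib]
    refine vL.map_le_sum fun i _ => ?_
    rw [map_smul, map_pow, ← smul_sub, Algebra.smul_def]
    obtain ⟨q, hq⟩ : ∃ q, (σ π) ^ (i : ℕ) - π ^ (i : ℕ) = (σ π - π) * q ∧ 0 ≤ vL q := by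
      refine ⟨_, (Commute.geom_sum₂_mul (Commute.all (σ π) π) i).symm.trans (mul_comm _ _), ?_⟩
      refine vL.map_le_sum fun j _ => ?_
      rw [vL.map_mul, vL.map_pow, vL.map_pow, val_algEquiv hL hK]
      exact add_nonneg (nsmul_nonneg hint _) (nsmul_nonneg hint _)
    rw [hq.1]
    refine coe_le_of_le (le_val_mul (le_val_algebraMap hL (ha0 i))
      (le_val_mul hlt (m := b + 1 + 1) (k := 0) hq.2)) ?_
    simp
  have hfix : σ π = π := by
    by_contra hne
    obtain ⟨m, hm⟩ := exists_val_eq vL (sub_ne_zero.2 hne)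
    have h2 := hhigh (max m (b + 1)) (le_max_right _ _) hmem π hint
    rw [hm, WithTop.coe_le_coe] at h2
    have := le_max_left m (b + 1)
    omega
  refine hσ (AlgEquiv.ext fun x => ?_)
  obtain ⟨a, ha, -⟩ := exists_power_expansion hL hπ isCoprime_one_left (u := 1) (t := 0)
    (by simp) x
  rw [ha]
  simp [map_sum, map_smul, hfix]

-- Euler's formula for the dual basis of the powers of `y`. By Lagrange interpolation of `X ^ k` at
-- the conjugates `σ y`, `σ ∈ H`, the sum is the coefficient of degree `card - 1` of `X ^ k`.
omit [FiniteDimensional K L] in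
lemma algEquiv_pow_mul_inv_prod [DecidableEq (L ≃ₐ[K] L)] (H : Subgroup (L ≃ₐ[K] L))
    (s : Finset (L ≃ₐ[K] L)) (hs : ∀ σ, σ ∈ s ↔ σ ∈ H) (y : L)
    (hy : ∀ σ ∈ H, σ ≠ 1 → σ y ≠ y) {k : ℕ} (hk : k < s.card) :
    ∑ σ ∈ s, σ (y ^ k * (∏ τ ∈ s.erase 1, (y - τ y))⁻¹) =
      if k = s.card - 1 then 1 else 0 := by
  have hinj : Set.InjOn (fun σ : L ≃ₐ[K] L => σ y) s := by
    intro σ hσ τ hτ h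
    by_contra hne
    refine hy (σ⁻¹ * τ) (H.mul_mem (H.inv_mem ((hs σ).1 hσ)) ((hs τ).1 hτ)) ?_ ?_
    · rw [Ne, inv_mul_eq_one]; exact hne
    · rw [AlgEquiv.mul_apply]
      simp only at h
      rw [← h, ← AlgEquiv.mul_apply, inv_mul_cancel, AlgEquiv.one_apply]
  have h := Lagrange.coeff_eq_sum hinj (P := (Polynomial.X : Polynomial L) ^ k) (by
    rw [Polynomial.degree_X_pow]; exact_mod_cast hk)
  rw [Polynomial.coeff_X_pow] at h
  rw [show (if k = s.card - 1 then (1 : L) else 0) = if s.card - 1 = k then 1 else 0 by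
    simp only [eq_comm], h]
  refine Finset.sum_congr rfl fun σ hσ => ?_
  rw [map_mul, map_inv₀, map_prod, map_pow, div_eq_mul_inv, Polynomial.eval_pow,
    Polynomial.eval_X]
  congr 2
  refine Finset.prod_bij (fun τ _ => σ * τ) ?_ ?_ ?_ ?_
  · intro τ hτ
    rw [Finset.mem_erase] at hτ ⊢
    refine ⟨fun h => hτ.1 (by simpa using h), ?_⟩
    exact (hs _).2 (H.mul_mem ((hs _).1 hσ) ((hs _).1 hτ.2))
  · intro τ _ τ' _ h
    exact mul_left_cancel h
  · intro τ hτ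
    rw [Finset.mem_erase] at hτ
    refine ⟨σ⁻¹ * τ, ?_, by simp⟩
    rw [Finset.mem_erase]
    refine ⟨fun h => hτ.1 (inv_mul_eq_one.1 h).symm, ?_⟩
    exact (hs _).2 (H.mul_mem (H.inv_mem ((hs _).1 hσ)) ((hs _).1 hτ.2))
  · intro τ _
    simp [AlgEquiv.mul_apply]

/-- With `u` the inverse of the product of the differences `y - τ y`, Euler's formula says that the
trace reads off the coefficient of `y ^ (N - 1) * u` in the expansion of `x`. That basis element has
valuation `(N - 1) * (s - c)`, which gives the bound; equality holds when `x` has its valuation in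
the same class modulo `N`, for then this term attains the valuation of `x`. -/
lemma val_trace [IsGalois K L] (hL : IsTotallyRamified vK vL) {y : L} {s c : ℤ}
    (hy : vL y = (s : WithTop ℤ)) (hs : IsCoprime s (Module.finrank K L))
    (hc : ∀ σ : L ≃ₐ[K] L, σ ≠ 1 → vL (y - σ y) = (c : WithTop ℤ)) {x : L} {m : ℤ}
    (hx : (m : WithTop ℤ) ≤ vL x) :
    ((m + (Module.finrank K L - 1) * (c - s) : ℤ) : WithTop ℤ) ≤
        vL (algebraMap K L (Algebra.trace K L x)) ∧
      (vL x = (m : WithTop ℤ) → s - c + m ≡ 0 [ZMOD Module.finrank K L] →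
        vL (algebraMap K L (Algebra.trace K L x)) =
          ((m + (Module.finrank K L - 1) * (c - s) : ℤ) : WithTop ℤ)) := by
  classical
  have hcard : (Finset.univ : Finset (L ≃ₐ[K] L)).card = Module.finrank K L := by
    rw [Finset.card_univ, ← Nat.card_eq_fintype_card, IsGalois.card_aut_eq_finrank]
  have hpos : 0 < Module.finrank K L := Module.finrank_pos
  set N := Module.finrank K L with hN
  set u : L := (∏ τ ∈ (Finset.univ : Finset (L ≃ₐ[K] L)).erase 1, (y - τ y))⁻¹ with hu
  have hval : vL u = ((-((N - 1) * c) : ℤ) : WithTop ℤ) := by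
    have := val_prod_eq (v := vL) (s := (Finset.univ : Finset (L ≃ₐ[K] L)).erase 1)
      (f := fun τ => y - τ y) (m := c) (fun τ hτ => hc τ (Finset.ne_of_mem_erase hτ))
    rw [Finset.card_erase_of_mem (Finset.mem_univ _), hcard, Nat.cast_sub hpos] at this
    exact_mod_cast val_inv_eq this
  have htr : ∀ k : ℕ, k < N → algebraMap K L (Algebra.trace K L (y ^ k * u)) =
      if k = N - 1 then 1 else 0 := by
    intro k hk
    rw [trace_eq_sum_automorphisms, ← hcard]
    refine algEquiv_pow_mul_inv_prod ⊤ _ (by simp) y (fun σ _ hσ h => ?_) (hcard ▸ hk)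
    have := hc σ hσ
    rw [h, sub_self, vL.map_zero] at this
    exact WithTop.top_ne_coe this
  obtain ⟨a, ha1, ha2, ha3⟩ := exists_power_expansion hL hy hs hval x
  let i0 : Fin N := ⟨N - 1, by omega⟩
  have hT : algebraMap K L (Algebra.trace K L x) = algebraMap K L (a i0) := by
    conv_lhs => rw [ha1]
    rw [map_sum, map_sum, Finset.sum_eq_single i0]
    · rw [map_smul, smul_eq_mul, map_mul, htr _ i0.2, if_pos rfl, mul_one]
    · intro i _ hi
      rw [map_smul, smul_eq_mul, map_mul, htr _ i.2, if_neg, mul_zero]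
      exact fun h => hi (Fin.ext h)
    · simp
  have hyu : vL (y ^ (N - 1) * u) = (((N - 1) * s - (N - 1) * c : ℤ) : WithTop ℤ) := by
    rw [val_mul_eq (val_pow_eq hy _) hval, Nat.cast_sub hpos]
    congr 1
  have hne : y ^ (N - 1) * u ≠ 0 := ne_zero_of_val hyu
  have hai : algebraMap K L (a i0) = (a i0 • (y ^ (N - 1) * u)) * (y ^ (N - 1) * u)⁻¹ := by
    rw [Algebra.smul_def, mul_inv_cancel_right₀ hne]
  rw [hT, hai]
  constructor
  · convert le_val_mul (hx.trans (ha2 i0)) (val_inv_eq hyu).ge using 2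
    ring
  · intro hxm hmod
    have h1 := ((ha3 m hxm) i0).1 (by
      refine Int.modEq_iff_dvd.2 ?_
      obtain ⟨q, hq⟩ := Int.modEq_iff_dvd.1 hmod
      refine ⟨-q + c - s, ?_⟩
      have : ((i0 : ℕ) : ℤ) = N - 1 := by simp [i0, Nat.cast_sub hpos]
      rw [this]
      linarith)
    rw [val_mul_eq h1 (val_inv_eq hyu)]
    congr 1; ring

end Ramification

/-! ### Artin-Schreier roots and the break. -/

section ArtinSchreier

variable {K L : Type*} [Field K] [Field L] [Algebra K L]

lemma exists_zmod_of_pow_eq {L : Type*} [Field L] (p : ℕ) [Fact p.Prime] [CharP L p] {x : L}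
    (hx : x ^ p = x) : ∃ a : ZMod p, x = ZMod.castHom (dvd_refl p) L a := by
  have h1 : x ∈ (⊥ : Subfield L) := (Subfield.mem_bot_iff_pow_eq_self L p).2 hx
  obtain ⟨a, ha⟩ := (bot_le : (⊥ : Subfield L) ≤ (ZMod.castHom (dvd_refl p) L).fieldRange) h1
  exact ⟨a, ha.symm⟩

/-- The homomorphism `σ ↦ σ w - w` attached to a root `w` of an Artin-Schreier equation. -/
lemma exists_artinSchreier_hom (p : ℕ) [Fact p.Prime] [CharP L p] {w : L} {e : K}
    (hw : w ^ p - w = algebraMap K L e) :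
    ∃ χ : (L ≃ₐ[K] L) → ZMod p, (∀ σ, σ w = w + ZMod.castHom (dvd_refl p) L (χ σ)) ∧
      (∀ σ τ, χ (σ * τ) = χ σ + χ τ) := by
  have h1 : ∀ σ : L ≃ₐ[K] L, ∃ a : ZMod p, σ w - w = ZMod.castHom (dvd_refl p) L a := by
    intro σ
    refine exists_zmod_of_pow_eq p ?_
    have h2 : σ w ^ p - σ w = w ^ p - w := by
      rw [← map_pow, ← map_sub, hw, AlgEquiv.commutes]
    rw [sub_pow_char]
    linear_combination h2
  choose χ hχ using h1
  have h3 : ∀ σ, σ w = w + ZMod.castHom (dvd_refl p) L (χ σ) := fun σ => by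
    rw [← hχ]; ring
  refine ⟨χ, h3, fun σ τ => ?_⟩
  apply (ZMod.castHom (dvd_refl p) L).injective
  have h4 := h3 (σ * τ)
  rw [AlgEquiv.mul_apply, h3 τ, map_add, h3 σ] at h4
  have h5 : σ (ZMod.castHom (dvd_refl p) L (χ τ)) = ZMod.castHom (dvd_refl p) L (χ τ) := by
    rw [← ZMod.natCast_zmod_val (χ τ), map_natCast, map_natCast]
  rw [h5] at h4
  rw [map_add]
  linear_combination -h4

/-- Lagrange interpolation of `X ^ (p - 1)` at the `p` points `w + i`: the leading coefficient `1`
is the sum divided by a product of differences, and this product is the same constant at every node.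
-/
lemma sum_add_zmod_pow {L : Type*} [Field L] (p : ℕ) [hp : Fact p.Prime] [CharP L p] (w : L) :
    ∃ κ : ZMod p, κ ≠ 0 ∧ ∑ i : ZMod p, (w + ZMod.castHom (dvd_refl p) L i) ^ (p - 1) =
      ZMod.castHom (dvd_refl p) L κ := by
  classical
  have hinj : Set.InjOn (fun i : ZMod p => w + ZMod.castHom (dvd_refl p) L i)
      (Finset.univ : Finset (ZMod p)) := fun i _ j _ h =>
    (ZMod.castHom (dvd_refl p) L).injective (add_left_cancel h)
  have hp1 := hp.out.one_lt
  have h := Lagrange.coeff_eq_sum hinj (P := (Polynomial.X : Polynomial L) ^ (p - 1)) (by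
    rw [Polynomial.degree_X_pow, Finset.card_univ, ZMod.card]
    exact_mod_cast (by omega : p - 1 < p))
  rw [Polynomial.coeff_X_pow, Finset.card_univ, ZMod.card, if_pos rfl] at h
  set κ : ZMod p := ∏ j ∈ Finset.univ.erase 0, (0 - j) with hκ
  have hκ0 : κ ≠ 0 := by
    refine Finset.prod_ne_zero_iff.2 fun j hj => ?_
    simpa using Finset.ne_of_mem_erase hj
  refine ⟨κ, hκ0, ?_⟩
  have hprod : ∀ i : ZMod p, ∏ j ∈ Finset.univ.erase i, ((w + ZMod.castHom (dvd_refl p) L i) -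
      (w + ZMod.castHom (dvd_refl p) L j)) = ZMod.castHom (dvd_refl p) L κ := by
    intro i
    rw [hκ, map_prod]
    refine Finset.prod_bij (fun j _ => j - i) ?_ ?_ ?_ ?_
    · intro j hj
      simpa [sub_eq_zero] using hj
    · intro j _ j' _ h
      simpa using h
    · intro j hj
      exact ⟨j + i, by simpa using hj, by simp⟩
    · intro j _
      simp only [map_sub, map_zero]; ring
  simp only [hprod, Polynomial.eval_pow, Polynomial.eval_X] at h
  rw [← Finset.sum_div] at h
  have h0 : ZMod.castHom (dvd_refl p) L κ ≠ 0 := (map_ne_zero _).2 hκ0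
  rw [eq_div_iff h0, one_mul] at h
  exact h.symm

lemma val_castHom {L : Type*} [Field L] (v : AddValuation L (WithTop ℤ)) (p : ℕ)
    [hp : Fact p.Prime] [CharP L p] {a : ZMod p} (ha : a ≠ 0) :
    v (ZMod.castHom (dvd_refl p) L a) = ((0 : ℤ) : WithTop ℤ) := by
  refine val_eq_of_pow_eq (k := p - 1) (by have := hp.out.one_lt; omega) ?_
  rw [← map_pow, ZMod.pow_card_sub_one_eq_one ha]
  simp

/-- In an extension with single ramification break `b`, a root `w ∉ K` of `X ^ p - X - e` with
`e ∈ K` forces `v e ≤ -b`. -/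
lemma val_le_of_artinSchreier [FiniteDimensional K L] [IsGalois K L]
    {vK : AddValuation K (WithTop ℤ)} {vL : AddValuation L (WithTop ℤ)}
    (p : ℕ) [hp : Fact p.Prime] [CharP L p]
    (hL : IsTotallyRamified vK vL) (hK : Function.Surjective vK) {b : ℤ} (hb : 0 < b)
    (hbreak : ramificationBreaks K vL = {b}) {w : L} {e : K}
    (hw : w ^ p - w = algebraMap K L e) (hwK : w ∉ Set.range (algebraMap K L)) :
    vK e ≤ ((-b : ℤ) : WithTop ℤ) := by
  classical
  -- If `e` had valuation at least `1 - b`, then `w ^ (p - 1) * x`, for a suitable `x`, would have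
  -- as trace a unit of the prime field, whereas `val_trace` makes that trace of positive valuation.
  by_contra hlt
  rw [not_le, lt_iff_add_one_le] at hlt
  obtain ⟨χ, hχ, hχa⟩ := exists_artinSchreier_hom p hw
  obtain ⟨π, hπ⟩ := hL.normalized ((1 : ℤ) : WithTop ℤ)
  have hval := fun σ hσ => val_sub_of_ramificationBreaks_eq hL hK hb hbreak hπ (σ := σ) hσ
  have hp1 := hp.out.one_lt
  -- surjectivity of `χ`
  have hχ1 : χ 1 = 0 := by simpa using hχa 1 1
  have hχpow : ∀ σ (k : ℕ), χ (σ ^ k) = k * χ σ := by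
    intro σ k
    induction k with
    | zero => simp [hχ1]
    | succ k ih => rw [pow_succ, hχa, ih]; push_cast; ring
  have hsurj : Function.Surjective χ := by
    obtain ⟨σ, hσ⟩ : ∃ σ, χ σ ≠ 0 := by
      by_contra hall
      push Not at hall
      refine hwK ?_
      rw [IsGalois.mem_range_algebraMap_iff_fixed]
      intro σ
      rw [hχ, hall, map_zero, add_zero]
    intro i
    refine ⟨σ ^ (i / χ σ).val, ?_⟩
    rw [hχpow, ZMod.natCast_zmod_val, div_mul_cancel₀ _ hσ]
  have hχinv : ∀ σ, χ σ⁻¹ = - χ σ := fun σ => by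
    have := hχa σ⁻¹ σ
    rw [inv_mul_cancel, hχ1] at this
    exact eq_neg_of_add_eq_zero_left this.symm
  let H : Subgroup (L ≃ₐ[K] L) :=
    { carrier := {σ | χ σ = 0}
      mul_mem' := fun {a b} ha hb => by
        simp only [Set.mem_ofPred_eq] at *
        rw [hχa, ha, hb, add_zero]
      one_mem' := hχ1
      inv_mem' := fun {a} ha => by
        simp only [Set.mem_ofPred_eq] at *
        rw [hχinv, ha, neg_zero] }
  set s : ZMod p → Finset (L ≃ₐ[K] L) := fun i => Finset.univ.filter fun σ => χ σ = i with hs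
  have hs0 : ∀ σ, σ ∈ s 0 ↔ σ ∈ H := fun σ => by simp [s, H]
  have hfib : ∀ σ0 : L ≃ₐ[K] L, s (χ σ0) = (s 0).map (mulLeftEmbedding σ0) := by
    intro σ0
    ext σ
    simp only [s, Finset.mem_filter, Finset.mem_univ, true_and, Finset.mem_map,
      mulLeftEmbedding_apply]
    constructor
    · intro h
      exact ⟨σ0⁻¹ * σ, by rw [hχa, hχinv, h, neg_add_cancel], by simp⟩
    · rintro ⟨τ, hτ, rfl⟩
      rw [hχa, hτ, add_zero]
  have hcard : Module.finrank K L = p * (s 0).card := by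
    rw [← IsGalois.card_aut_eq_finrank, Nat.card_eq_fintype_card, ← Finset.card_univ,
      Finset.card_eq_sum_card_fiberwise (f := χ) (t := Finset.univ) (fun _ _ => Finset.mem_univ _)]
    have : ∀ i ∈ (Finset.univ : Finset (ZMod p)), (s i).card = (s 0).card := by
      intro i _
      obtain ⟨σ0, rfl⟩ := hsurj i
      rw [hfib, Finset.card_map]
    rw [Finset.sum_congr rfl this]
    simp [ZMod.card]
  have hpos : 0 < (s 0).card := Finset.card_pos.2 ⟨1, (hs0 1).2 H.one_mem⟩
  set q := (s 0).card with hq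
  -- Euler's formula for `H = ker χ` provides an element with trace `1` over `H`, of known
  -- valuation.
  set x : L := π ^ (q - 1) * (∏ τ ∈ (s 0).erase 1, (π - τ π))⁻¹ with hx
  have hxval : vL x = ((-((q - 1) * b) : ℤ) : WithTop ℤ) := by
    have := val_prod_eq (v := vL) (s := (s 0).erase 1)
      (f := fun τ => π - τ π) (m := b + 1) (fun τ hτ => hval τ (Finset.ne_of_mem_erase hτ))
    rw [Finset.card_erase_of_mem ((hs0 1).2 H.one_mem)] at this
    rw [hx, val_mul_eq (val_pow_eq hπ _) (val_inv_eq this), Nat.cast_sub hpos]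
    congr 1; push_cast; ring
  have hxtr : ∑ σ ∈ s 0, σ x = 1 := by
    rw [algEquiv_pow_mul_inv_prod H (s 0) hs0 π (fun σ _ hσ h => ?_) (by omega), if_pos rfl]
    have := hval σ hσ
    rw [h, sub_self, vL.map_zero] at this
    exact WithTop.top_ne_coe this
  have hxtr' : ∀ i, ∑ σ ∈ s i, σ x = 1 := by
    intro i
    obtain ⟨σ0, rfl⟩ := hsurj i
    rw [hfib, Finset.sum_map]
    simp only [mulLeftEmbedding_apply, AlgEquiv.mul_apply]
    rw [← map_sum, hxtr, map_one]
  obtain ⟨κ, hκ0, hκ⟩ := sum_add_zmod_pow p w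
  -- On the fibre of `χ` over `i`, all `σ` send `w` to `w + i`, and the conjugates of `x` over that
  -- fibre add up to `1`.
  have htr : algebraMap K L (Algebra.trace K L (w ^ (p - 1) * x)) =
      ZMod.castHom (dvd_refl p) L κ := by
    rw [trace_eq_sum_automorphisms, ← hκ, ← Finset.sum_fiberwise (s := Finset.univ) (g := χ)]
    refine Finset.sum_congr rfl fun i _ => ?_
    rw [← mul_one ((w + _) ^ (p - 1)), ← hxtr' i, Finset.mul_sum]
    refine Finset.sum_congr rfl fun σ hσ => ?_
    rw [map_mul, map_pow, hχ, (Finset.mem_filter.1 hσ).2]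
  have hwval : ((-b * q + 1 : ℤ) : WithTop ℤ) ≤ vL w := by
    have hw0 : w ≠ 0 := by
      rintro rfl
      exact hwK ⟨0, map_zero _⟩
    obtain ⟨m, hm⟩ := exists_val_eq vL hw0
    rw [hm, WithTop.coe_le_coe]
    by_contra hneg
    push Not at hneg
    have hm0 : m < 0 := by nlinarith
    have h1 : vL (w ^ p - w) = ((p * m : ℤ) : WithTop ℤ) := by
      rw [sub_eq_add_neg]
      refine val_add_eq_left (val_pow_eq hm p) ?_
      rw [vL.map_neg, hm, WithTop.coe_lt_coe]
      nlinarith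
    have h2 := le_val_algebraMap hL hlt
    rw [← hw, h1, WithTop.coe_le_coe, hcard] at h2
    push_cast at h2
    nlinarith [mul_pos (show (0 : ℤ) < p by omega) (show (0 : ℤ) < q by omega)]
  -- The lower bound adds up to `p - 1`, which is positive, while the trace has valuation `0`.
  have h1 := (val_trace hL hπ isCoprime_one_left hval
    (le_val_mul (le_val_pow hwval (p - 1)) hxval.ge)).1
  rw [htr, val_castHom vL p hκ0, WithTop.coe_le_coe, hcard, Nat.cast_sub hp1.le] at h1
  push_cast at h1
  nlinarith

end ArtinSchreier

/-! ### The Moore matrix and its dual vector. -/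

section Moore

variable {F : Type*} [Field F] (p : ℕ) [hp : Fact p.Prime] [CharP F p]

include hp in
omit [CharP F p] in
lemma castHom_pow_char [CharP F p] (a : ZMod p) (m : ℕ) :
    (ZMod.castHom (dvd_refl p) F a) ^ p ^ m = ZMod.castHom (dvd_refl p) F a := by
  rw [← map_pow, ZMod.pow_card_pow]

/-- The Moore matrix `Ω` of `ω` is invertible, and `c` solves the system with right-hand side the
first unit vector. Taking `p ^ j`-th powers of these equations shows that the matrix of the `c i ^ p
^ j` times the transpose of `Ω` is lower triangular with ones on the diagonal, so it is invertible
too. -/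
lemma exists_dual_of_linearIndependent {n : ℕ} (hn : 0 < n) {ω : Fin n → F}
    (hω : ∀ s : Fin n → ZMod p, ∑ i, ZMod.castHom (dvd_refl p) F (s i) * ω i = 0 → s = 0) :
    ∃ c : Fin n → F, (∀ m < n, ∑ i, c i * ω i ^ p ^ m = if m = 0 then 1 else 0) ∧
      ∀ s : Fin n → F, (∀ j < n, ∑ i, c i ^ p ^ j * s i = 0) → s = 0 := by
  classical
  let Ω : Matrix (Fin n) (Fin n) F := Matrix.of fun m i => ω i ^ p ^ (m : ℕ)
  have hp1 := hp.out.one_lt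
  have hΩ : Ω.det ≠ 0 := by
    intro hdet
    obtain ⟨l, hl0, hl⟩ := Matrix.exists_vecMul_eq_zero_iff.2 hdet
    -- A left kernel vector gives an additive polynomial of degree at most `p ^ (n - 1)` that
    -- vanishes on the `p ^ n` combinations of the `ω i` over the prime field.
    let Q : Polynomial F := ∑ m : Fin n, Polynomial.C (l m) * Polynomial.X ^ p ^ (m : ℕ)
    have hroot : ∀ s : Fin n → ZMod p,
        Q.eval (∑ i, ZMod.castHom (dvd_refl p) F (s i) * ω i) = 0 := by
      intro s
      simp only [Q, Polynomial.eval_finsetSum, Polynomial.eval_mul, Polynomial.eval_C,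
        Polynomial.eval_pow, Polynomial.eval_X, sum_pow_char_pow, mul_pow, castHom_pow_char,
        Finset.mul_sum]
      rw [Finset.sum_comm]
      refine Finset.sum_eq_zero fun i _ => ?_
      have h1 : ∑ m, l m * ω i ^ p ^ (m : ℕ) = 0 := congrFun hl i
      rw [← mul_zero (ZMod.castHom (dvd_refl p) F (s i)), ← h1, Finset.mul_sum]
      exact Finset.sum_congr rfl fun m _ => by ring
    have hinj : Function.Injective fun s : Fin n → ZMod p =>
        ∑ i, ZMod.castHom (dvd_refl p) F (s i) * ω i := by
      intro s s' h
      refine sub_eq_zero.1 (hω (s - s') ?_)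
      simp only [Pi.sub_apply, map_sub, sub_mul, Finset.sum_sub_distrib]
      exact sub_eq_zero.2 h
    have hdeg : Q.natDegree < Fintype.card (Fin n → ZMod p) := by
      rw [Fintype.card_fun, ZMod.card, Fintype.card_fin]
      refine lt_of_le_of_lt (Polynomial.natDegree_sum_le_of_forall_le (n := p ^ (n - 1)) _ _
        fun m _ => (Polynomial.natDegree_C_mul_X_pow_le _ _).trans ?_) ?_
      · exact Nat.pow_le_pow_right hp1.le (by omega)
      · exact Nat.pow_lt_pow_right hp1 (by omega)
    have hQ := Polynomial.eq_zero_of_natDegree_lt_card_of_eval_eq_zero Q hinj hroot hdeg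
    refine hl0 (funext fun m => ?_)
    have h2 : Q.coeff (p ^ (m : ℕ)) = l m := by
      simp only [Q, Polynomial.finsetSum_coeff, Polynomial.coeff_C_mul, Polynomial.coeff_X_pow]
      rw [Finset.sum_eq_single m]
      · simp
      · intro j _ hj
        rw [if_neg, mul_zero]
        intro h
        exact hj (Fin.ext (Nat.pow_right_injective hp1 h).symm)
      · simp
    rw [← h2, hQ, Polynomial.coeff_zero, Pi.zero_apply]
  let c : Fin n → F := (Ω⁻¹).mulVec (Pi.single ⟨0, hn⟩ 1)
  have hc : ∀ m < n, ∑ i, c i * ω i ^ p ^ m = if m = 0 then 1 else 0 := by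
    intro m hm
    have h1 : Ω.mulVec c = Pi.single ⟨0, hn⟩ 1 := by
      rw [Matrix.mulVec_mulVec, Matrix.mul_nonsing_inv _ hΩ.isUnit, Matrix.one_mulVec]
    have h2 := congrFun h1 ⟨m, hm⟩
    simp only [Matrix.mulVec, dotProduct, Ω, Matrix.of_apply, Pi.single_apply, Fin.mk.injEq] at h2
    rw [← h2]
    exact Finset.sum_congr rfl fun i _ => mul_comm _ _
  refine ⟨c, hc, fun s hs => ?_⟩
  let C : Matrix (Fin n) (Fin n) F := Matrix.of fun j i => c i ^ p ^ (j : ℕ)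
  have hent : ∀ j m : Fin n, j ≤ m → (C * Ω.transpose) j m = if j = m then 1 else 0 := by
    intro j m hjm
    have h1 := hc (m - j : ℕ) (by omega)
    simp only [Matrix.mul_apply, C, Ω, Matrix.of_apply, Matrix.transpose_apply]
    have h2 := congrArg (· ^ p ^ (j : ℕ)) h1
    simp only [sum_pow_char_pow, mul_pow, ← pow_mul, ← pow_add,
      Nat.sub_add_cancel (Fin.le_def.1 hjm)] at h2
    rw [h2]
    by_cases h : j = m
    · simp [h]
    · have : ¬ ((m : ℕ) - j = 0) := fun h' => h (Fin.ext (by have := Fin.le_def.1 hjm; omega))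
      rw [if_neg this, if_neg h, zero_pow (pow_ne_zero _ hp.out.ne_zero)]
  have hdet : (C * Ω.transpose).det = 1 := by
    rw [Matrix.det_of_isLowerTriangular]
    · exact Finset.prod_eq_one fun i _ => by rw [hent i i le_rfl, if_pos rfl]
    · intro i j hij
      rw [hent i j (le_of_lt (by simpa using hij)), if_neg]
      exact ne_of_lt (by simpa using hij)
  have hC : C.det ≠ 0 := by
    intro h
    rw [Matrix.det_mul, h, zero_mul] at hdet
    exact zero_ne_one hdet
  refine Matrix.eq_zero_of_mulVec_eq_zero hC (funext fun j => ?_)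
  simpa [Matrix.mulVec, dotProduct, C] using hs j j.2

end Moore

/-! ### Leading coefficients in the residue field. -/

section Residue

variable {F K : Type*} [Field F] [Field K] [Algebra F K] {vK : AddValuation K (WithTop ℤ)}

lemma exists_residue (hK : IsLocalField F vK) {x t : K} {m : ℤ} (hx : vK x = (m : WithTop ℤ))
    (ht : vK t = (m : WithTop ℤ)) :
    ∃ c : F, c ≠ 0 ∧ (m : WithTop ℤ) < vK (x - algebraMap F K c * t) := by
  have h1 := val_div_eq hx ht
  rw [sub_self] at h1
  obtain ⟨c, hc⟩ := hK.coeff_residue (x / t) h1.ge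
  have ht0 := ne_zero_of_val ht
  refine ⟨c, ?_, ?_⟩
  · rintro rfl
    rw [map_zero, sub_zero, h1] at hc
    exact lt_irrefl _ hc
  · have h2 : x - algebraMap F K c * t = (x / t - algebraMap F K c) * t := by
      field_simp
    rw [lt_iff_add_one_le, h2]
    have h3 : ((1 : ℤ) : WithTop ℤ) ≤ vK (x / t - algebraMap F K c) := by
      rw [← WithTop.coe_zero, lt_iff_add_one_le] at hc
      exact hc
    convert le_val_mul h3 ht.ge using 2
    ring

lemma val_coeff (hK : IsLocalField F vK) (c : F) : ((0 : ℤ) : WithTop ℤ) ≤ vK (algebraMap F K c) := by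
  rcases eq_or_ne c 0 with rfl | hc
  · simp
  · rw [hK.coeff_unit c hc]; simp

lemma exists_pow_char_eq (p : ℕ) [Fact p.Prime] [CharP F p] [PerfectField F] (c : F) :
    ∃ d : F, d ^ p = c := by
  have : PerfectRing F p := PerfectField.toPerfectRing p
  exact ⟨(frobeniusEquiv F p).symm c, (frobeniusEquiv F p).apply_symm_apply c⟩

end Residue

/-! ### Consequences of the single break for Artin-Schreier data. -/

section Data

variable {F K L : Type*} [Field F] [Field K] [Field L] [Algebra F K] [Algebra K L]
  [FiniteDimensional K L] [IsGalois K L] (p : ℕ) [hp : Fact p.Prime] [CharP L p] [CharP K p]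
  {vK : AddValuation K (WithTop ℤ)} {vL : AddValuation L (WithTop ℤ)}

/-- The single ramification break is prime to `p`. -/
lemma not_dvd_break [CharP F p] [PerfectField F] (hK : IsLocalField F vK)
    (hL : IsTotallyRamified vK vL) {b : ℤ} (hb : 0 < b) (hbreak : ramificationBreaks K vL = {b})
    {w : L} {e : K} (hw : w ^ p - w = algebraMap K L e)
    (hwK : w ∉ Set.range (algebraMap K L)) (he : vK e = ((-b : ℤ) : WithTop ℤ)) :
    ¬ (p : ℤ) ∣ b := by
  rintro ⟨b', hb'⟩
  have hp1 := hp.out.one_lt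
  -- If `p` divided `b`, the leading term of `e` would be a `p`-th power `r ^ p`, as `F` is perfect.
  -- Replacing `w` by `w - r` changes `e` into `e - r ^ p + r`, whose pole has order less than `b`,
  -- against `val_le_of_artinSchreier`.
  obtain ⟨r0, hr0⟩ := hK.normalized ((-b' : ℤ) : WithTop ℤ)
  have hr0p : vK (r0 ^ p) = ((-b : ℤ) : WithTop ℤ) := by
    rw [val_pow_eq hr0]; congr 1; rw [hb']; ring
  obtain ⟨c, hc0, hc⟩ := exists_residue hK he hr0p
  obtain ⟨d, rfl⟩ := exists_pow_char_eq p c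
  set r : K := algebraMap F K d * r0 with hr
  have hrp : algebraMap F K (d ^ p) * r0 ^ p = r ^ p := by rw [hr, mul_pow, map_pow]
  have hrval : ((-b' : ℤ) : WithTop ℤ) ≤ vK r := by
    convert le_val_mul (val_coeff hK d) hr0.ge using 2
    ring
  rw [hrp] at hc
  have hb'pos : 0 < b' := by
    by_contra h
    have : (p : ℤ) * b' ≤ 0 := mul_nonpos_of_nonneg_of_nonpos (by positivity) (by omega)
    omega
  have hlt : ((-b : ℤ) : WithTop ℤ) < vK (e - r ^ p + r) := by
    rw [lt_iff_add_one_le] at hc ⊢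
    refine vK.map_le_add hc (coe_le_of_le hrval ?_)
    have : (2 : ℤ) ≤ p := by exact_mod_cast hp1
    nlinarith
  refine absurd hlt (not_lt.2 (val_le_of_artinSchreier p hL hK.normalized hb hbreak
    (w := w - algebraMap K L r) ?_ ?_))
  · rw [sub_pow_char, map_add, map_sub, ← hw, map_pow]; ring
  · rintro ⟨y, hy⟩
    exact hwK ⟨y + r, by rw [map_add, hy]; ring⟩

/-- The isomorphism of the Galois group with `(ZMod p)^n` given by Artin-Schreier generators. -/
lemma exists_galois_coordinates {n : ℕ} (hcard : Nat.card (L ≃ₐ[K] L) = p ^ n) {x : Fin n → L}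
    {z : Fin n → K} (hx : ∀ i, x i ^ p - x i = algebraMap K L (z i))
    (hgen : IntermediateField.adjoin K (Set.range x) = ⊤) :
    ∃ a : (L ≃ₐ[K] L) → Fin n → ZMod p, Function.Bijective a ∧
      (∀ σ τ, a (σ * τ) = a σ + a τ) ∧
      ∀ σ i, σ (x i) = x i + ZMod.castHom (dvd_refl p) L (a σ i) := by
  choose a ha haa using fun i => exists_artinSchreier_hom p (hx i)
  have hadd : ∀ σ τ, (fun i => a i (σ * τ)) = (fun i => a i σ) + fun i => a i τ := fun σ τ =>
    funext fun i => haa i σ τ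
  refine ⟨fun σ i => a i σ, ?_, hadd, fun σ i => ha i σ⟩
  rw [Nat.bijective_iff_injective_and_card]
  constructor
  · intro σ τ h
    ext y
    have hy : y ∈ IntermediateField.adjoin K (Set.range x) := hgen ▸ IntermediateField.mem_top
    induction hy using IntermediateField.adjoin_induction with
    | mem y hy =>
      obtain ⟨i, rfl⟩ := hy
      rw [ha, ha]
      have := congrFun h i
      simp only at this
      rw [this]
    | algebraMap y => simp
    | add y z _ _ h1 h2 => rw [map_add, map_add, h1, h2]
    | inv y _ h1 => rw [map_inv₀, map_inv₀, h1]
    | mul y z _ _ h1 h2 => rw [map_mul, map_mul, h1, h2]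
  · rw [hcard, Nat.card_fun]; simp

/-- The residues occurring in Artin-Schreier data are linearly independent over the prime field. -/
lemma linearIndependent_of_data [CharP F p] (hL : IsTotallyRamified vK vL)
    (hK : Function.Surjective vK) {b : ℤ} (hb : 0 < b) (hbreak : ramificationBreaks K vL = {b})
    {n : ℕ} {x : Fin n → L} {z ε : Fin n → K} {β : K} {ω : Fin n → F}
    (hx : ∀ i, x i ^ p - x i = algebraMap K L (z i))
    (hz : ∀ i, z i = algebraMap F K (ω i) ^ p ^ n * β + ε i)
    (hε : ∀ i, ((-b : ℤ) : WithTop ℤ) < vK (ε i))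
    {a : (L ≃ₐ[K] L) → Fin n → ZMod p} (ha : Function.Surjective a)
    (hax : ∀ σ i, σ (x i) = x i + ZMod.castHom (dvd_refl p) L (a σ i))
    (s : Fin n → ZMod p) (hs : ∑ i, ZMod.castHom (dvd_refl p) F (s i) * ω i = 0) : s = 0 := by
  classical
  by_contra hne
  obtain ⟨i, hi⟩ := Function.ne_iff.1 hne
  have hcast : ∀ t : ZMod p, algebraMap F K (ZMod.castHom (dvd_refl p) F t) =
      ZMod.castHom (dvd_refl p) K t := fun t => by
    rw [← ZMod.natCast_zmod_val t, map_natCast, map_natCast, map_natCast]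
  have hcast' : ∀ t : ZMod p, algebraMap K L (ZMod.castHom (dvd_refl p) K t) =
      ZMod.castHom (dvd_refl p) L t := fun t => by
    rw [← ZMod.natCast_zmod_val t, map_natCast, map_natCast, map_natCast]
  -- Raising the relation to the power `p ^ n` eliminates `β`, since Frobenius fixes the `s i`.
  -- Hence `∑ s i * x i` is a root of an Artin-Schreier equation whose constant has valuation
  -- greater than `-b`.
  have hsum : ∑ i, ZMod.castHom (dvd_refl p) K (s i) * z i =
      ∑ i, ZMod.castHom (dvd_refl p) K (s i) * ε i := by
    have h1 := congrArg (fun y => algebraMap F K y ^ p ^ n * β) hs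
    simp only [map_sum, map_mul, sum_pow_char_pow, mul_pow, hcast, castHom_pow_char, map_zero,
      zero_pow (pow_ne_zero n hp.out.ne_zero), zero_mul, Finset.sum_mul] at h1
    simp only [hz, mul_add, Finset.sum_add_distrib, ← mul_assoc, h1, zero_add]
  have hw : (∑ i, ZMod.castHom (dvd_refl p) L (s i) * x i) ^ p -
      ∑ i, ZMod.castHom (dvd_refl p) L (s i) * x i =
      algebraMap K L (∑ i, ZMod.castHom (dvd_refl p) K (s i) * ε i) := by
    rw [← hsum, map_sum]
    have h1 := sum_pow_char_pow p 1 Finset.univ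
      (fun i => ZMod.castHom (dvd_refl p) L (s i) * x i)
    rw [pow_one] at h1
    rw [h1, ← Finset.sum_sub_distrib]
    refine Finset.sum_congr rfl fun i _ => ?_
    have h2 := castHom_pow_char (F := L) p (s i) 1
    rw [pow_one] at h2
    rw [mul_pow, h2, map_mul, ← hx, hcast']
    ring
  have hval : ((-b : ℤ) : WithTop ℤ) < vK (∑ i, ZMod.castHom (dvd_refl p) K (s i) * ε i) := by
    refine lt_val_sum fun i _ => ?_
    have := hε i
    rw [lt_iff_add_one_le] at this ⊢
    rcases eq_or_ne (s i) 0 with h0 | h0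
    · simp [h0]
    · convert le_val_mul (val_castHom vK p h0).ge this using 2
      ring
  refine absurd hval (not_lt.2 (val_le_of_artinSchreier p hL hK hb hbreak hw ?_))
  -- The root does not lie in `K`: the automorphism with coordinate vector the `i`-th unit vector
  -- moves it by `s i ≠ 0`.
  intro hmem
  rw [IsGalois.mem_range_algebraMap_iff_fixed] at hmem
  obtain ⟨σ, hσ⟩ := ha (Pi.single i 1)
  have h1 := hmem σ
  have h3 : ∀ t : ZMod p, σ (ZMod.castHom (dvd_refl p) L t) = ZMod.castHom (dvd_refl p) L t :=
    fun t => by rw [← hcast', AlgEquiv.commutes]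
  simp only [map_sum, map_mul, hax, hσ, h3, mul_add, Finset.sum_add_distrib] at h1
  rw [add_eq_left, Finset.sum_eq_single i] at h1
  · rw [Pi.single_eq_same, map_one, mul_one] at h1
    exact hi ((map_eq_zero _).1 h1)
  · intro j _ hj
    rw [Pi.single_eq_of_ne hj, map_zero, mul_zero]
  · simp

end Data

/-- The embedding of the coefficient field in `L`. -/
abbrev coeffHom (F K L : Type*) [Field F] [Field K] [Field L] [Algebra F K] [Algebra K L] : F →+* L :=
  (algebraMap K L).comp (algebraMap F K)

/-- An element `Y` of valuation `-b` on which the Galois group, with coordinates `a`, acts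
by `σ Y = Y + ∑ i, c i * a σ i + (higher order)`, and whose differences `σ Y - Y` lie in a subfield
of degree `p` over `K`. -/
structure IsScaffold {F K L : Type*} [Field F] [Field K] [Field L] [Algebra F K] [Algebra K L]
    (vL : AddValuation L (WithTop ℤ)) (p n : ℕ) [Fact p.Prime] [CharP F p] (b : ℤ) (Y : L)
    (a : (L ≃ₐ[K] L) → Fin n → ZMod p) (c : Fin n → F) (i₀ : Fin n) : Prop where
  val : vL Y = ((-b : ℤ) : WithTop ℤ)
  bijective : Function.Bijective a
  map_mul : ∀ σ τ, a (σ * τ) = a σ + a τ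
  dual : ∀ s : Fin n → F, (∀ j < n, ∑ i, c i ^ p ^ j * s i = 0) → s = 0
  shift : ∀ σ : L ≃ₐ[K] L, ((0 : ℤ) : WithTop ℤ) <
    vL (σ Y - Y - coeffHom F K L (∑ i, c i * ZMod.castHom (dvd_refl p) F (a σ i)))
  fixed : ∀ σ τ : L ≃ₐ[K] L, a τ i₀ = 0 → τ (σ Y - Y) = σ Y - Y

/-! ### Approximate `p`-th roots that are almost Galois invariant. -/

section Scaffold

variable {F K L : Type*} [Field F] [Field K] [Field L] [Algebra F K] [Algebra K L]
  (p : ℕ) [hp : Fact p.Prime]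
  {vK : AddValuation K (WithTop ℤ)} {vL : AddValuation L (WithTop ℤ)}

include hp in
omit [Field F] [Field K] [Algebra F K] [Algebra K L] in
lemma le_val_artinSchreier_root {w : L} {m : ℤ} (hm : 0 ≤ m)
    (hw : ((-(p * m) : ℤ) : WithTop ℤ) ≤ vL (w ^ p - w)) : ((-m : ℤ) : WithTop ℤ) ≤ vL w := by
  rcases eq_or_ne w 0 with rfl | hw0
  · simp
  have hp1 : (1 : ℤ) < p := by exact_mod_cast hp.out.one_lt
  obtain ⟨r, hr⟩ := exists_val_eq vL hw0
  rw [hr, WithTop.coe_le_coe]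
  by_contra hneg
  push Not at hneg
  rw [sub_eq_add_neg, val_add_eq_left (val_pow_eq hr p) (by
    rw [vL.map_neg, hr, WithTop.coe_lt_coe]; nlinarith), WithTop.coe_le_coe] at hw
  nlinarith

variable [FiniteDimensional K L]

/-- Elements of `K` of valuation greater than `-b / p ^ (n - 2)` are approximated by `p`-th powers of
elements `f ∈ K(x₀)` which are almost fixed by the Galois group. -/
lemma exists_approx_root [CharP F p] [CharP L p] [PerfectField F] (hK : IsLocalField F vK)
    (hL : IsTotallyRamified vK vL) {b : ℤ} (hb : 0 < b) (hpb : ¬ (p : ℤ) ∣ b) {n : ℕ} (hn : 2 ≤ n)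
    (hN : Module.finrank K L = p ^ n) {x₀ : L} {z₀ : K}
    (hx : x₀ ^ p - x₀ = algebraMap K L z₀) (hz : vK z₀ = ((-b : ℤ) : WithTop ℤ)) (k : ℕ) :
    ∀ E : K, ((-k : ℤ) : WithTop ℤ) ≤ vK E →
      ((-(b * p ^ 2) : ℤ) : WithTop ℤ) < vL (algebraMap K L E) →
      ∃ f : L, (∀ σ : L ≃ₐ[K] L, σ x₀ = x₀ → σ f = f) ∧
        (∀ σ : L ≃ₐ[K] L, ((0 : ℤ) : WithTop ℤ) < vL (σ f - f)) ∧
        ((-(b * p) : ℤ) : WithTop ℤ) < vL (f ^ p - algebraMap K L E) := by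
  have hp1 : (1 : ℤ) < p := by exact_mod_cast hp.out.one_lt
  obtain ⟨n', rfl⟩ := Nat.exists_eq_add_of_le hn
  set P : ℤ := p ^ n' with hP
  have hP1 : 1 ≤ P := one_le_pow₀ hp1.le
  have hN' : (Module.finrank K L : ℤ) = p ^ 2 * P := by rw [hN, hP]; push_cast; ring
  have hzL := val_algebraMap hL hz
  have hx0 : ((-(b * (p * P)) : ℤ) : WithTop ℤ) ≤ vL x₀ := by
    refine le_val_artinSchreier_root p (by positivity) ?_
    rw [hx, hzL, hN', WithTop.coe_le_coe]
    apply le_of_eq; ring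
  have hpow : ∀ (u w : L) (m r : ℤ) (j : ℕ), (m : WithTop ℤ) ≤ vL u → (m : WithTop ℤ) ≤ vL (u + w) →
      (r : WithTop ℤ) ≤ vL w →
      (((j : ℤ) * m + (r - m) : ℤ) : WithTop ℤ) ≤ vL ((u + w) ^ j - u ^ j) := by
    intro u w m r j hu huw hw
    rcases Nat.eq_zero_or_pos j with rfl | hj
    · simp
    rw [← Commute.mul_geom_sum₂ (Commute.all _ _), add_sub_cancel_left]
    have h1 : (((j - 1 : ℤ) * m : ℤ) : WithTop ℤ) ≤
        vL (∑ i ∈ Finset.range j, (u + w) ^ i * u ^ (j - 1 - i)) := by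
      refine vL.map_le_sum fun i hi => ?_
      rw [Finset.mem_range] at hi
      convert le_val_mul (le_val_pow huw i) (le_val_pow hu (j - 1 - i)) using 2
      rw [Nat.cast_sub (by omega), Nat.cast_sub (by omega)]
      push_cast; ring
    convert le_val_mul hw h1 using 2
    ring
  induction k with
  | zero =>
    intro E hE _
    refine ⟨0, by simp, by simp, ?_⟩
    have h1 := le_val_algebraMap hL hE
    rw [zero_pow hp.out.ne_zero, zero_sub, vL.map_neg]
    refine coe_lt_of_le h1 ?_
    have : 0 < b * p := by positivity
    simpa using this
  | succ k ih =>
    intro E hE hEL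
    by_cases hEk : ((-k : ℤ) : WithTop ℤ) ≤ vK E
    · exact ih E hEk hEL
    have hE0 : E ≠ 0 := by
      rintro rfl
      simp at hEk
    obtain ⟨m, hm⟩ := exists_val_eq vK hE0
    have hmk : m = -(k + 1 : ℤ) := by
      rw [hm, WithTop.coe_le_coe] at hE hEk
      push_cast at hE
      omega
    have hmP : -b < m * P := by
      rw [val_algebraMap hL hm, hN', WithTop.coe_lt_coe] at hEL
      have : (p : ℤ) ^ 2 * -b < p ^ 2 * (m * P) := by linarith
      exact lt_of_mul_lt_mul_left this (by positivity)
    have hmb : -b < m := by nlinarith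
    -- As `b` is prime to `p`, the leading term of `E` can be matched by `e ^ p * z₀ ^ j`. Since `z₀
    -- = x₀ ^ p - x₀`, its approximate `p`-th root is `e * x₀ ^ j`; the remainder has a smaller pole
    -- and is left to the induction.
    obtain ⟨j, q, hjq⟩ : ∃ (j : ℕ) (q : ℤ), m + b * j = p * q := by
      have hcop : IsCoprime (b : ℤ) p :=
        ((Nat.prime_iff_prime_int.1 hp.out).coprime_iff_not_dvd.2 hpb).symm
      obtain ⟨u, w, huw⟩ := hcop
      refine ⟨((-m * u) % p).toNat, ?_⟩
      rw [Int.toNat_of_nonneg (Int.emod_nonneg _ (by omega)), Int.emod_def]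
      refine ⟨m * w - b * (-m * u / p), ?_⟩
      linear_combination -m * huw
    obtain ⟨t, ht⟩ := hK.normalized (q : WithTop ℤ)
    have htz : vK (t ^ p * z₀ ^ j) = (m : WithTop ℤ) := by
      rw [val_mul_eq (val_pow_eq ht p) (val_pow_eq hz j)]
      congr 1; linarith
    obtain ⟨c, hc0, hc⟩ := exists_residue hK hm htz
    obtain ⟨d, rfl⟩ := exists_pow_char_eq p c
    set e : K := algebraMap F K d * t with he
    have hd0 : d ≠ 0 := fun h => hc0 (by rw [h, zero_pow hp.out.ne_zero])
    have heq : algebraMap F K (d ^ p) * (t ^ p * z₀ ^ j) = e ^ p * z₀ ^ j := by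
      rw [he, map_pow]; ring
    have heval : vK e = (q : WithTop ℤ) := by
      have := val_mul_eq (hK.coeff_unit d hd0) ht
      rwa [zero_add] at this
    clear_value e
    have heL := val_algebraMap hL heval
    rw [heq, lt_iff_add_one_le] at hc
    have hE'L : ((-(b * p ^ 2) : ℤ) : WithTop ℤ) < vL (algebraMap K L (E - e ^ p * z₀ ^ j)) := by
      refine coe_lt_of_le (le_val_algebraMap hL hc) ?_
      rw [hN']
      nlinarith [mul_pos (show (0 : ℤ) < p ^ 2 by positivity) (show 0 < P by omega)]
    obtain ⟨f', hf1, hf2, hf3⟩ := ih (E - e ^ p * z₀ ^ j)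
      (coe_le_of_le hc (by omega)) hE'L
    have hq : P * p * (p * q) = P * p * (m + b * j) := by rw [hjq]
    refine ⟨algebraMap K L e * x₀ ^ j + f', ?_, ?_, ?_⟩
    · intro σ hσ
      rw [map_add, map_mul, map_pow, hσ, AlgEquiv.commutes, hf1 σ hσ]
    · intro σ
      obtain ⟨χ, hχ, -⟩ := exists_artinSchreier_hom p hx
      have hχ0 : ((0 : ℤ) : WithTop ℤ) ≤ vL (ZMod.castHom (dvd_refl p) L (χ σ)) := by
        rcases eq_or_ne (χ σ) 0 with h | h
        · simp [h]
        · exact (val_castHom vL p h).ge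
      have h1 : σ (algebraMap K L e * x₀ ^ j + f') - (algebraMap K L e * x₀ ^ j + f') =
          algebraMap K L e * ((x₀ + ZMod.castHom (dvd_refl p) L (χ σ)) ^ j - x₀ ^ j) +
            (σ f' - f') := by
        rw [map_add, map_mul, map_pow, AlgEquiv.commutes, hχ]; ring
      rw [h1]
      have h2 := hf2 σ
      rw [lt_iff_add_one_le] at h2 ⊢
      refine vL.map_le_add ?_ h2
      refine coe_le_of_le (le_val_mul heL.ge (hpow x₀ _ _ 0 j hx0 (vL.map_le_add hx0
        (coe_le_of_le hχ0 ?_)) hχ0)) ?_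
      · have : 0 < b * (p * P) := by positivity
        omega
      -- The bound is `p * P * (m + b)`, where `p * P = p ^ (n - 1)`, and `m > -b`.
      · rw [hN']
        have h3 : (0 : ℤ) < p * P * (m + b) :=
          mul_pos (mul_pos (by omega) (by omega)) (by omega)
        linarith
    · have h1 : (algebraMap K L e * x₀ ^ j + f') ^ p - algebraMap K L E =
          algebraMap K L e ^ p * ((algebraMap K L z₀ + x₀) ^ j - algebraMap K L z₀ ^ j) +
            (f' ^ p - algebraMap K L (E - e ^ p * z₀ ^ j)) := by
        have h2 : (x₀ ^ j) ^ p = (algebraMap K L z₀ + x₀) ^ j := by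
          rw [← hx, sub_add_cancel, ← pow_mul, ← pow_mul, mul_comm]
        rw [add_pow_char, mul_pow, h2, map_sub, map_mul, map_pow, map_pow]; ring
      rw [h1]
      rw [lt_iff_add_one_le] at hf3 ⊢
      refine vL.map_le_add ?_ hf3
      have h0 : -(p ^ 2 * P * b) ≤ -(b * (p * P)) := by
        have : 0 ≤ b * (p * P) * (p - 1) := by
          have : (0 : ℤ) ≤ p - 1 := by omega
          positivity
        nlinarith
      refine coe_le_of_le (le_val_mul (val_pow_eq heL p).ge
        (hpow _ _ (-(p ^ 2 * P * b)) (-(b * (p * P))) j ?_ ?_ hx0)) ?_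
      · rw [hzL, hN', WithTop.coe_le_coe]; apply le_of_eq; ring
      · refine vL.map_le_add ?_ (coe_le_of_le hx0 h0)
        rw [hzL, hN', WithTop.coe_le_coe]; apply le_of_eq; ring
      -- The bound is `p ^ 2 * P * m + b * p * (p - 1) * P`. The hypothesis on `E` says `m * P ≥ 1 -
      -- b`, which is just enough to exceed `-(b * p)`.
      · rw [hN']
        have h3 : (p : ℤ) ^ 2 * (-b + 1) ≤ p ^ 2 * (m * P) :=
          mul_le_mul_of_nonneg_left (by omega) (by positivity)
        have h4 : b * p * (p - 1) ≤ b * p * (p - 1) * P := by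
          refine le_mul_of_one_le_right ?_ hP1
          have : (0 : ℤ) ≤ p - 1 := by omega
          positivity
        nlinarith

end Scaffold

/-! ### Construction of the element `Y`. -/

section Scaffold

variable {F K L : Type*} [Field F] [Field K] [Field L] [Algebra F K] [Algebra K L]
  (p : ℕ) [hp : Fact p.Prime]
  {vK : AddValuation K (WithTop ℤ)} {vL : AddValuation L (WithTop ℤ)}

lemma coeffHom_castHom [CharP F p] [CharP L p] (t : ZMod p) :
    coeffHom F K L (ZMod.castHom (dvd_refl p) F t) = ZMod.castHom (dvd_refl p) L t := by
  rw [← ZMod.natCast_zmod_val t, map_natCast, map_natCast, map_natCast]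

lemma algEquiv_coeffHom (σ : L ≃ₐ[K] L) (c : F) : σ (coeffHom F K L c) = coeffHom F K L c :=
  σ.commutes _

lemma artinSchreier_root_pow {R : Type*} [CommRing R] [CharP R p] {x z : R} (hx : x ^ p - x = z)
    (n : ℕ) : x ^ p ^ n = x + ∑ m ∈ Finset.range n, z ^ p ^ m := by
  induction n with
  | zero => simp
  | succ n ih =>
    rw [Finset.sum_range_succ, ← add_assoc, ← ih, ← hx, sub_pow_char_pow, ← pow_mul, ← pow_succ']
    ring

variable [FiniteDimensional K L]

lemma coeffHom_val_of_ne_zero (hK : IsLocalField F vK) (hL : IsTotallyRamified vK vL) {c : F}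
    (hc : c ≠ 0) : vL (coeffHom F K L c) = ((0 : ℤ) : WithTop ℤ) := by
  have := val_algebraMap hL (hK.coeff_unit c hc : vK _ = ((0 : ℤ) : WithTop ℤ))
  rwa [mul_zero] at this

lemma coeffHom_val (hK : IsLocalField F vK) (hL : IsTotallyRamified vK vL) (c : F) :
    ((0 : ℤ) : WithTop ℤ) ≤ vL (coeffHom F K L c) := by
  rcases eq_or_ne c 0 with rfl | hc
  · simp
  · exact (coeffHom_val_of_ne_zero hK hL hc).ge

lemma break_group_nontrivial {b : ℤ} (hbreak : ramificationBreaks K vL = {b}) :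
    Nontrivial (L ≃ₐ[K] L) := by
  by_contra hne
  rw [not_nontrivial_iff_subsingleton] at hne
  have hb : b ∈ ramificationBreaks K vL := by rw [hbreak]; rfl
  refine hb.2 (Set.ext fun σ => ?_)
  obtain rfl : σ = 1 := Subsingleton.elim _ _
  simp [ramificationGroup]

/-- `Y` is the combination of the `x i` with the dual coefficients `c`, corrected by `f`. Its
valuation is found from `Y ^ p ^ n`, in which duality removes all powers `B ^ p ^ m` with `m ≥ 1`.
The action on `Y` is explicit because each `x i` is moved by an element of the prime field and `f`
is almost fixed. -/
lemma exists_scaffold [IsGalois K L] [CharP F p] [CharP K p] [CharP L p] [PerfectField F]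
    (hK : IsLocalField F vK) (hL : IsTotallyRamified vK vL) {n : ℕ}
    (hcard : Nat.card (L ≃ₐ[K] L) = p ^ n) {b : ℤ} (hb : 0 < b)
    (hbreak : ramificationBreaks K vL = {b}) {β : K} {ω : Fin n → F} {ε : Fin n → K}
    (hAS : IsArtinSchreierData L vK p n b β ω ε)
    (hε : ∀ i, ((-(b * p ^ 2) : ℤ) : WithTop ℤ) < vL (algebraMap K L (ε i))) :
    ¬ (p : ℤ) ∣ b ∧ ∃ (Y : L) (a : (L ≃ₐ[K] L) → Fin n → ZMod p) (c : Fin n → F) (i₀ : Fin n),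
      IsScaffold vL p n b Y a c i₀ := by
  have hp1 : (1 : ℤ) < p := by exact_mod_cast hp.out.one_lt
  have hn : 0 < n := by
    rcases Nat.eq_zero_or_pos n with rfl | hn
    · have := break_group_nontrivial hbreak
      have h1 := Finite.one_lt_card (α := L ≃ₐ[K] L)
      rw [hcard, pow_zero] at h1
      exact absurd h1 (lt_irrefl _)
    · exact hn
  have hN : Module.finrank K L = p ^ n := by rw [← hcard, IsGalois.card_aut_eq_finrank]
  obtain ⟨x, hx, hgen⟩ := hAS.generates
  set z : Fin n → K := fun i => algebraMap F K (ω i) ^ p ^ n * β + ε i with hz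
  obtain ⟨a, habij, hamul, hax⟩ := exists_galois_coordinates p hcard hx hgen
  have hω := linearIndependent_of_data p hL hK.normalized hb hbreak hx (fun i => rfl) hAS.val_eps
    habij.2 hax
  obtain ⟨c, hc, hdual⟩ := exists_dual_of_linearIndependent p hn hω
  let i₀ : Fin n := ⟨0, hn⟩
  have hω0 : ω i₀ ≠ 0 := by
    intro h
    have := hω (Pi.single i₀ 1) (by
      refine Finset.sum_eq_zero fun i _ => ?_
      by_cases hi : i = i₀
      · rw [hi, h, mul_zero]
      · rw [Pi.single_eq_of_ne hi, map_zero, zero_mul])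
    simpa using congrFun this i₀
  have hzval : vK (z i₀) = ((-b : ℤ) : WithTop ℤ) := by
    refine val_add_eq_left ?_ (hAS.val_eps i₀)
    have := val_mul_eq (hK.coeff_unit _ (pow_ne_zero (p ^ n) hω0)) hAS.val_beta
    rwa [zero_add, map_pow] at this
  have hx0K : x i₀ ∉ Set.range (algebraMap K L) := by
    intro hmem
    rw [IsGalois.mem_range_algebraMap_iff_fixed] at hmem
    obtain ⟨σ, hσ⟩ := habij.2 (Pi.single i₀ 1)
    have := hmem σ
    rw [hax, hσ, Pi.single_eq_same, map_one] at this
    exact one_ne_zero (add_eq_left.1 this)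
  have hpb := not_dvd_break p hK hL hb hbreak (hx i₀) hx0K hzval
  refine ⟨hpb, ?_⟩
  -- change the data so that the first error term vanishes
  set η : Fin n → F := fun i => (ω i / ω i₀) ^ p ^ n with hη
  set ε' : Fin n → K := fun i => ε i - algebraMap F K (η i) * ε i₀ with hε'
  have hηω : ∀ i, η i = ω i ^ p ^ n * (ω i₀ ^ p ^ n)⁻¹ := fun i => by
    simp only [hη, div_pow, div_eq_mul_inv, mul_pow, inv_pow]
  have hηω' : ∀ i, algebraMap F K (η i) * algebraMap F K (ω i₀) ^ p ^ n =
      algebraMap F K (ω i) ^ p ^ n := fun i => by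
    rw [hηω, ← map_pow, ← map_mul, inv_mul_cancel_right₀ (pow_ne_zero _ hω0), map_pow]
  have hz' : ∀ i, z i = algebraMap F K (η i) * z i₀ + ε' i := by
    intro i
    simp only [hz, hε']
    linear_combination -β * hηω' i
  have hε'0 : ε' i₀ = 0 := by
    have : η i₀ = 1 := by rw [hηω, mul_inv_cancel₀ (pow_ne_zero _ hω0)]
    simp [hε', this]
  have hε'L : ∀ i, ((-(b * p ^ 2) : ℤ) : WithTop ℤ) < vL (algebraMap K L (ε' i)) := by
    intro i
    have h1 := hε i
    have h2 := hε i₀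
    rw [lt_iff_add_one_le] at h1 h2 ⊢
    rw [hε', map_sub, map_mul]
    refine vL.map_le_sub h1 ?_
    have := le_val_mul (coeffHom_val hK hL (η i)) h2
    rwa [zero_add] at this
  -- The `p ^ (n - 1)`-th power of `E` is the only error term in `Y ^ p ^ n` that size alone does
  -- not control; `f ^ p ^ n` has to cancel it.
  set E : K := ∑ i, algebraMap F K (c i ^ p) * ε' i with hE
  have hEL : ((-(b * p ^ 2) : ℤ) : WithTop ℤ) < vL (algebraMap K L E) := by
    rw [hE, map_sum]
    refine lt_val_sum fun i _ => ?_
    have h1 := hε'L i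
    rw [lt_iff_add_one_le] at h1 ⊢
    have := le_val_mul (coeffHom_val hK hL (c i ^ p)) h1
    rwa [zero_add, RingHom.comp_apply, ← map_mul] at this
  obtain ⟨f, hf1, hf2, hf3⟩ : ∃ f : L, (∀ σ : L ≃ₐ[K] L, σ (x i₀) = x i₀ → σ f = f) ∧
        (∀ σ : L ≃ₐ[K] L, ((0 : ℤ) : WithTop ℤ) < vL (σ f - f)) ∧
        ((-(b * p) : ℤ) : WithTop ℤ) < vL (f ^ p - algebraMap K L E) := by
    by_cases hn2 : 2 ≤ n
    · obtain ⟨k, hk⟩ : ∃ k : ℕ, ((-k : ℤ) : WithTop ℤ) ≤ vK E := by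
        rcases eq_or_ne E 0 with h0 | h0
        · exact ⟨0, by simp [h0]⟩
        · obtain ⟨m, hm⟩ := exists_val_eq vK h0
          exact ⟨m.natAbs, by rw [hm, WithTop.coe_le_coe]; omega⟩
      exact exists_approx_root p hK hL hb hpb hn2 hN (hx i₀) hzval k E hk hEL
    -- For `n = 1` the bound on `ε` gives nothing, but the normalization `ε' i₀ = 0` already makes
    -- `E` vanish.
    · refine ⟨0, by simp, by simp, ?_⟩
      have h0 : E = 0 := by
        refine Finset.sum_eq_zero fun i _ => ?_
        have : i = i₀ := Fin.ext (by have := i.2; simp only [i₀]; omega)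
        rw [this, hε'0, mul_zero]
      rw [h0, zero_pow hp.out.ne_zero, map_zero, sub_zero, vL.map_zero]
      exact WithTop.coe_lt_top _
  set Y : L := ∑ i, coeffHom F K L (c i) * x i - f with hY
  have hact : ∀ σ : L ≃ₐ[K] L, σ Y - Y =
      coeffHom F K L (∑ i, c i * ZMod.castHom (dvd_refl p) F (a σ i)) - (σ f - f) := by
    intro σ
    have h1 : σ Y = ∑ i, coeffHom F K L (c i) * (x i + ZMod.castHom (dvd_refl p) L (a σ i)) -
        σ f := by
      rw [hY, map_sub, map_sum]
      congr 1
      refine Finset.sum_congr rfl fun i _ => ?_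
      rw [map_mul, algEquiv_coeffHom, hax]
    have h2 : coeffHom F K L (∑ i, c i * ZMod.castHom (dvd_refl p) F (a σ i)) =
        ∑ i, coeffHom F K L (c i) * ZMod.castHom (dvd_refl p) L (a σ i) := by
      rw [map_sum]
      exact Finset.sum_congr rfl fun i _ => by rw [map_mul, coeffHom_castHom]
    rw [h1, h2, hY]
    simp only [mul_add, Finset.sum_add_distrib]
    ring
  refine ⟨Y, a, c, i₀, ?_, habij, hamul, hdual, ?_, ?_⟩
  · refine val_eq_of_pow_eq (k := p ^ n) (pow_pos hp.out.pos n) ?_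
    set B : L := algebraMap K L (z i₀ * algebraMap F K (ω i₀ ^ p ^ n)⁻¹) with hB
    have hBval : vL B = ((((p ^ n : ℕ) : ℤ) * -b : ℤ) : WithTop ℤ) := by
      have h1 := val_mul_eq hzval (hK.coeff_unit _ (inv_ne_zero (pow_ne_zero (p ^ n) hω0)))
      rw [add_zero] at h1
      rw [hB, val_algebraMap hL h1, hN]
    have hzB : ∀ i, algebraMap K L (z i) = coeffHom F K L (ω i) ^ p ^ n * B +
        algebraMap K L (ε' i) := by
      intro i
      rw [hz' i, hB, ← map_pow, RingHom.comp_apply, ← map_mul, ← map_add]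
      congr 2
      rw [mul_comm (z i₀), ← mul_assoc, ← map_mul, hηω]
    -- The coefficient of `B ^ p ^ m` is the `p ^ n`-th power of `∑ c i * ω i ^ p ^ m`, which is `1`
    -- for `m = 0` and `0` for `0 < m < n`.
    have hsum : ∀ m < n, ∑ i, coeffHom F K L (c i) ^ p ^ n * algebraMap K L (z i) ^ p ^ m =
        (if m = 0 then B else 0) +
          ∑ i, coeffHom F K L (c i) ^ p ^ n * algebraMap K L (ε' i) ^ p ^ m := by
      intro m hm
      have h1 := congrArg (fun y => coeffHom F K L y ^ p ^ n * B ^ p ^ m) (hc m hm)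
      simp only [map_sum, map_mul, map_pow, sum_pow_char_pow, mul_pow, Finset.sum_mul] at h1
      simp only [hzB, add_pow_char_pow, mul_add, Finset.sum_add_distrib]
      congr 1
      trans ∑ i, coeffHom F K L (c i) ^ p ^ n * (coeffHom F K L (ω i) ^ p ^ m) ^ p ^ n * B ^ p ^ m
      · refine Finset.sum_congr rfl fun i _ => ?_
        rw [mul_pow, ← pow_mul, ← pow_mul, mul_comm (p ^ n) (p ^ m), mul_assoc]
      · rw [h1]
        split_ifs with h0
        · rw [h0]; simp
        · rw [map_zero, zero_pow (pow_ne_zero _ hp.out.ne_zero), zero_mul]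
    have hYp : Y ^ p ^ n = B + (∑ i, coeffHom F K L (c i) ^ p ^ n * x i +
        ∑ m ∈ Finset.range (n - 1), ∑ i, coeffHom F K L (c i) ^ p ^ n *
          algebraMap K L (ε' i) ^ p ^ m - (f ^ p - algebraMap K L E) ^ p ^ (n - 1)) := by
      have h1 : (algebraMap K L E) ^ p ^ (n - 1) =
          ∑ i, coeffHom F K L (c i) ^ p ^ n * algebraMap K L (ε' i) ^ p ^ (n - 1) := by
        rw [hE, map_sum, sum_pow_char_pow]
        refine Finset.sum_congr rfl fun i _ => ?_
        rw [map_mul, mul_pow, map_pow, map_pow, ← pow_mul, ← pow_succ', Nat.sub_add_cancel hn]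
        rfl
      have h2 : Y ^ p ^ n = ∑ i, coeffHom F K L (c i) ^ p ^ n * (x i +
          ∑ m ∈ Finset.range n, algebraMap K L (z i) ^ p ^ m) - f ^ p ^ n := by
        rw [hY, sub_pow_char_pow, sum_pow_char_pow]
        congr 1
        refine Finset.sum_congr rfl fun i _ => ?_
        rw [mul_pow, artinSchreier_root_pow p (hx i)]
      have h3 : ∑ i, coeffHom F K L (c i) ^ p ^ n *
          ∑ m ∈ Finset.range n, algebraMap K L (z i) ^ p ^ m = B +
          ∑ m ∈ Finset.range n, ∑ i, coeffHom F K L (c i) ^ p ^ n *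
            algebraMap K L (ε' i) ^ p ^ m := by
        simp only [Finset.mul_sum]
        rw [Finset.sum_comm, Finset.sum_congr rfl fun m hm => hsum m (Finset.mem_range.1 hm),
          Finset.sum_add_distrib, Finset.sum_ite_eq' (Finset.range n) 0 fun _ => B,
          if_pos (Finset.mem_range.2 hn)]
      rw [h2]
      simp only [mul_add, Finset.sum_add_distrib]
      rw [h3, sub_pow_char_pow, ← pow_mul, ← pow_succ', Nat.sub_add_cancel hn, h1]
      have h4 : ∀ g : ℕ → L, ∑ m ∈ Finset.range n, g m =
          ∑ m ∈ Finset.range (n - 1), g m + g (n - 1) := by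
        intro g
        rw [← Finset.sum_range_succ, Nat.sub_add_cancel hn]
      rw [h4]
      ring
    have hpow : (p : ℤ) ^ n = p ^ (n - 1) * p := by
      rw [← pow_succ, Nat.sub_add_cancel hn]
    have hppos : (0 : ℤ) < p ^ (n - 1) := by positivity
    have hcpow : ∀ i, ((0 : ℤ) : WithTop ℤ) ≤ vL (coeffHom F K L (c i) ^ p ^ n) := by
      intro i
      rw [← map_pow]; exact coeffHom_val hK hL _
    rw [hYp]
    refine val_add_eq_left hBval ?_
    rw [lt_iff_add_one_le, Nat.cast_pow]
    refine vL.map_le_sub (vL.map_le_add (vL.map_le_sum fun i _ => ?_)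
      (vL.map_le_sum fun m hm => vL.map_le_sum fun i _ => ?_)) ?_
    · have hzi : ((-b : ℤ) : WithTop ℤ) ≤ vK (z i) := by
        refine vK.map_le_add ?_ (hAS.val_eps i).le
        have := le_val_mul (val_coeff hK (ω i ^ p ^ n)) hAS.val_beta.ge
        rwa [zero_add, map_pow] at this
      have h1 := le_val_algebraMap hL hzi
      rw [hN, ← hx i, Nat.cast_pow] at h1
      have h2 := le_val_artinSchreier_root p (m := p ^ (n - 1) * b) (by positivity) (by
        convert h1 using 2
        rw [hpow]; ring)
      refine coe_le_of_le (le_val_mul (hcpow i) h2) ?_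
      rw [hpow]
      have : (0 : ℤ) < p ^ (n - 1) * b := by positivity
      nlinarith
    -- Here `m + 2 ≤ n`, so the bound `-(b * p ^ 2)` on the error still gives a valuation above `-(b
    -- * p ^ n)` after taking the `p ^ m`-th power.
    · rw [Finset.mem_range] at hm
      have h1 := hε'L i
      rw [lt_iff_add_one_le] at h1
      refine coe_le_of_le (le_val_mul (hcpow i) (le_val_pow h1 (p ^ m))) ?_
      have h2 : (p : ℤ) ^ m * p ^ 2 ≤ p ^ n := by
        rw [← pow_add]
        exact pow_le_pow_right₀ hp1.le (by omega)
      have h3 : (1 : ℤ) ≤ p ^ m := one_le_pow₀ hp1.le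
      push_cast
      nlinarith
    · rw [lt_iff_add_one_le] at hf3
      refine coe_le_of_le (le_val_pow hf3 (p ^ (n - 1))) ?_
      rw [hpow]
      push_cast
      nlinarith
  · intro σ
    rw [hact, sub_sub_cancel_left, vL.map_neg]
    exact hf2 σ
  · intro σ τ hτ
    have hτx : τ (x i₀) = x i₀ := by rw [hax, hτ, map_zero, add_zero]
    -- The coordinates `a` are injective and additive, so the Galois group is abelian.
    have hcomm : τ (σ f) = σ (τ f) := by
      rw [← AlgEquiv.mul_apply, ← AlgEquiv.mul_apply]
      congr 1
      apply habij.1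
      rw [hamul, hamul, add_comm]
    rw [hact, map_sub, map_sub, algEquiv_coeffHom, hcomm, hf1 τ hτx]

end Scaffold

/-! ### Shifts of valuation by elements of the group ring. -/

section Shift

variable {F K L : Type*} [Field F] [Field K] [Field L] [Algebra F K] [Algebra K L]
  [FiniteDimensional K L]

lemma act_eq_sum (γ : GroupRing F K L) (x : L) :
    act γ x = ∑ σ, coeffHom F K L (γ.coeff σ) * σ x :=
  Finsupp.sum_fintype _ _ fun σ => by simp

lemma act_sum_smul {ι : Type*} (γ : GroupRing F K L) (s : Finset ι) (k : ι → K) (x : ι → L) :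
    act γ (∑ i ∈ s, k i • x i) = ∑ i ∈ s, k i • act γ (x i) := by
  simp only [act_eq_sum, map_sum, map_smul, Finset.mul_sum, Finset.smul_sum, mul_smul_comm]
  exact Finset.sum_comm

/-- Induction by Pascal's rule, as the inner binomial coefficients of `p ^ n` vanish. Thus in `Y ^
(p ^ n - 1)` no term of the binomial expansion is lost. -/
lemma choose_pow_sub_one {R : Type*} [CommRing R] (p : ℕ) [hp : Fact p.Prime] [CharP R p] (n k : ℕ)
    (hk : k < p ^ n) : (((p ^ n - 1).choose k : ℕ) : R) = (-1) ^ k := by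
  induction k with
  | zero => simp
  | succ k ih =>
    have h1 : (((p ^ n).choose (k + 1) : ℕ) : R) = 0 := by
      rw [CharP.cast_eq_zero_iff R p]
      exact hp.out.dvd_choose_pow (by omega) (by omega)
    have h2 : p ^ n = (p ^ n - 1) + 1 := by omega
    rw [h2, Nat.choose_succ_succ, Nat.cast_add, ih (by omega)] at h1
    rw [pow_succ]
    linear_combination h1

variable (p : ℕ) [hp : Fact p.Prime] [CharP F p] [CharP L p]
  {vK : AddValuation K (WithTop ℤ)} {vL : AddValuation L (WithTop ℤ)}
  {n : ℕ} {b : ℤ} {Y : L} {a : (L ≃ₐ[K] L) → Fin n → ZMod p} {c : Fin n → F} {i₀ : Fin n}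

/-- The leading coefficient of `σ Y - Y`. -/
def leadCoeff (p : ℕ) [Fact p.Prime] [CharP F p] {n : ℕ} (a : (L ≃ₐ[K] L) → Fin n → ZMod p)
    (c : Fin n → F) (σ : L ≃ₐ[K] L) : F :=
  ∑ i, c i * ZMod.castHom (dvd_refl p) F (a σ i)

omit [FiniteDimensional K L] [CharP L p] in
lemma leadCoeff_pow (σ : L ≃ₐ[K] L) (j : ℕ) :
    leadCoeff p a c σ ^ p ^ j = ∑ i, c i ^ p ^ j * ZMod.castHom (dvd_refl p) F (a σ i) := by
  rw [leadCoeff, sum_pow_char_pow]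
  exact Finset.sum_congr rfl fun i _ => by rw [mul_pow, castHom_pow_char]

namespace IsScaffold

variable (hS : IsScaffold vL p n b Y a c i₀)

include hS

omit [FiniteDimensional K L] [CharP L p] in
lemma map_one : a 1 = 0 := by simpa using hS.map_mul 1 1

omit [FiniteDimensional K L] [CharP L p] in
lemma map_inv (σ : L ≃ₐ[K] L) : a σ⁻¹ = -a σ := by
  have := hS.map_mul σ⁻¹ σ
  rw [inv_mul_cancel, hS.map_one] at this
  exact eq_neg_of_add_eq_zero_left this.symm

-- If the leading coefficient vanishes, so do its Frobenius powers. These pair the vector `a σ` with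
-- the rows `c i ^ p ^ j`, and `dual` forces `a σ = 0`.
omit [FiniteDimensional K L] [CharP L p] in
lemma leadCoeff_ne_zero {σ : L ≃ₐ[K] L} (hσ : σ ≠ 1) : leadCoeff p a c σ ≠ 0 := by
  intro h
  refine hσ (hS.bijective.1 ?_)
  rw [hS.map_one]
  have := hS.dual (fun i => ZMod.castHom (dvd_refl p) F (a σ i)) fun j _ => by
    rw [← leadCoeff_pow, h, zero_pow (pow_ne_zero _ hp.out.ne_zero)]
  exact funext fun i => (map_eq_zero _).1 (congrFun this i)

omit [CharP L p] in
lemma val_sub_nonneg (hK : IsLocalField F vK) (hL : IsTotallyRamified vK vL) (σ : L ≃ₐ[K] L) :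
    ((0 : ℤ) : WithTop ℤ) ≤ vL (σ Y - Y) := by
  have h1 := vL.map_le_add (hS.shift σ).le (coeffHom_val hK hL (leadCoeff p a c σ))
  rwa [leadCoeff, sub_add_cancel] at h1

omit [CharP L p] in
lemma val_sub_eq_zero (hK : IsLocalField F vK) (hL : IsTotallyRamified vK vL) {σ : L ≃ₐ[K] L}
    (hσ : σ ≠ 1) : vL (Y - σ Y) = ((0 : ℤ) : WithTop ℤ) := by
  have h1 := val_add_eq_left (coeffHom_val_of_ne_zero hK hL (hS.leadCoeff_ne_zero p hσ))
    (hS.shift σ)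
  rwa [leadCoeff, add_sub_cancel, vL.map_sub_swap] at h1

omit [CharP L p] in
/-- Elements of the intermediate field of degree `p` have valuation divisible by `p ^ (n - 1)`. -/
lemma dvd_val_of_fixed [IsGalois K L] (hK : Function.Surjective vK) (hL : IsTotallyRamified vK vL)
    (hN : Module.finrank K L = p ^ n) {y : L} (hy : ∀ τ : L ≃ₐ[K] L, a τ i₀ = 0 → τ y = y) {m : ℤ}
    (hm : vL y = (m : WithTop ℤ)) : (p : ℤ) ^ (n - 1) ∣ m := by
  choose s hs using fun i : ZMod p => hS.bijective.2 (Pi.single i₀ i)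
  -- The product over coset representatives is the norm to `K` of `y` from the fixed field of the
  -- subgroup `a τ i₀ = 0`. Its valuation is `p * m` and also a multiple of `p ^ n`.
  have hfix : ∀ τ : L ≃ₐ[K] L, τ (∏ i, s i y) = ∏ i, s i y := by
    intro τ
    rw [map_prod]
    refine Fintype.prod_equiv (Equiv.addRight (a τ i₀)) _ _ fun i => ?_
    have h2 := hy ((s (i + a τ i₀))⁻¹ * (τ * s i)) (by
      rw [hS.map_mul, hS.map_mul, hS.map_inv, hs, hs]
      simp only [Pi.add_apply, Pi.neg_apply, Pi.single_eq_same]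
      ring)
    have h3 := congrArg (s (i + a τ i₀)) h2
    rw [← AlgEquiv.mul_apply, mul_inv_cancel_left, AlgEquiv.mul_apply] at h3
    exact h3
  obtain ⟨k, hk⟩ := (IsGalois.mem_range_algebraMap_iff_fixed _).2 hfix
  have h1 := val_prod_eq (v := vL) (s := Finset.univ) (f := fun i => s i y) (m := m) fun i _ => by
    rw [val_algEquiv hL hK, hm]
  have hk0 : k ≠ 0 := by
    rintro rfl
    rw [← hk, _root_.map_zero, vL.map_zero] at h1
    exact WithTop.top_ne_coe h1
  obtain ⟨r, hr⟩ := exists_val_eq vK hk0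
  have hn : 0 < n := i₀.pos
  rw [← hk, val_algebraMap hL hr, WithTop.coe_inj, Finset.card_univ, ZMod.card, hN] at h1
  refine ⟨r, ?_⟩
  have hp0 : (p : ℤ) ≠ 0 := by exact_mod_cast hp.out.ne_zero
  apply mul_left_cancel₀ hp0
  rw [← h1, ← mul_assoc, ← pow_succ', Nat.sub_add_cancel hn]
  push_cast; ring

/-- An element of the augmentation ideal outside its square shifts valuations by at least a number
`S`, and by exactly `S` on elements of valuation congruent to `b`. -/
lemma exists_shift [IsGalois K L] (hK : IsLocalField F vK) (hL : IsTotallyRamified vK vL)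
    (hN : Module.finrank K L = p ^ n) (hb : 0 < b) (hpb : ¬ (p : ℤ) ∣ b) {γ : GroupRing F K L}
    (hγ0 : ∑ σ, γ.coeff σ = 0) (hγ : ∃ j < n, ∑ σ, γ.coeff σ * leadCoeff p a c σ ^ p ^ j ≠ 0) :
    ∃ S : ℤ, 0 ≤ S ∧ S ≤ b * p ^ (n - 1) ∧
      (∀ (x : L) (m : ℤ), (m : WithTop ℤ) ≤ vL x → ((m + S : ℤ) : WithTop ℤ) ≤ vL (act γ x)) ∧
      ∀ (x : L) (m : ℤ), vL x = (m : WithTop ℤ) → m ≡ b [ZMOD (p ^ n : ℕ)] →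
        vL (act γ x) = ((m + S : ℤ) : WithTop ℤ) := by
  have hp1 := hp.out.one_lt
  have hn : 0 < n := i₀.pos
  have hcop : ∀ k, IsCoprime ((p : ℤ) ^ k) b := fun k =>
    (((Nat.prime_iff_prime_int.1 hp.out).coprime_iff_not_dvd.2 hpb)).pow_left
  have hY0 : Y ≠ 0 := ne_zero_of_val hS.val
  -- Expanding `(Y + (σ Y - Y)) ^ i` binomially and summing over `σ` gives `γ (Y ^ i)` in terms of
  -- these moments; the zeroth one is the augmentation, hence `0`.
  set D : ℕ → L := fun k => ∑ σ, coeffHom F K L (γ.coeff σ) * (σ Y - Y) ^ k with hD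
  have hD0 : D 0 = 0 := by
    simp only [hD, pow_zero, mul_one, ← map_sum, hγ0, _root_.map_zero]
  have hDval : ∀ k, ((0 : ℤ) : WithTop ℤ) ≤ vL (D k) := fun k => vL.map_le_sum fun σ _ => by
    have := le_val_mul (coeffHom_val hK hL (γ.coeff σ))
      (le_val_pow (hS.val_sub_nonneg p hK hL σ) k)
    rwa [mul_zero, add_zero] at this
  have hDdvd : ∀ k (m : ℤ), vL (D k) = (m : WithTop ℤ) → (p : ℤ) ^ (n - 1) ∣ m := by
    intro k m hm
    refine hS.dvd_val_of_fixed p hK.normalized hL hN (fun τ hτ => ?_) hm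
    simp only [hD, map_sum]
    refine Finset.sum_congr rfl fun σ _ => ?_
    rw [_root_.map_mul, algEquiv_coeffHom, map_pow, hS.fixed σ τ hτ]
  set d : ℕ → L := fun k => D k * (Y ^ k)⁻¹ with hd
  have hdval : ∀ k (m : ℤ), vL (d k) = (m : WithTop ℤ) → ∃ r : ℤ, 0 ≤ r ∧
      m = b * k + p ^ (n - 1) * r := by
    intro k m hm
    have hDk : D k ≠ 0 := by
      intro h
      rw [hd] at hm
      simp only [h, zero_mul, vL.map_zero] at hm
      exact WithTop.top_ne_coe hm
    obtain ⟨q, hq⟩ := exists_val_eq vL hDk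
    obtain ⟨r, rfl⟩ := hDdvd k q hq
    rw [hd] at hm
    simp only at hm
    rw [val_mul_eq hq (val_inv_eq (val_pow_eq hS.val k)), WithTop.coe_inj] at hm
    have h0 := hDval k
    rw [hq, WithTop.coe_le_coe] at h0
    exact ⟨r, nonneg_of_mul_nonneg_right h0 (by positivity), by rw [← hm]; ring⟩
  obtain ⟨j, hj, hjγ⟩ := hγ
  -- Frobenius is additive, so `D (p ^ j)` is congruent to `∑ γ_σ * leadCoeff σ ^ p ^ j`, a nonzero
  -- constant; it is a unit.
  have hdj : vL (d (p ^ j)) = ((b * p ^ j : ℤ) : WithTop ℤ) := by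
    have h1 : D (p ^ j) = coeffHom F K L (∑ σ, γ.coeff σ * leadCoeff p a c σ ^ p ^ j) +
        ∑ σ, coeffHom F K L (γ.coeff σ) *
          (σ Y - Y - coeffHom F K L (leadCoeff p a c σ)) ^ p ^ j := by
      rw [map_sum, ← Finset.sum_add_distrib]
      refine Finset.sum_congr rfl fun σ _ => ?_
      rw [_root_.map_mul, map_pow, sub_pow_char_pow (σ Y - Y)]
      ring
    have h2 : vL (D (p ^ j)) = ((0 : ℤ) : WithTop ℤ) := by
      rw [h1]
      refine val_add_eq_left (coeffHom_val_of_ne_zero hK hL hjγ) (lt_val_sum fun σ _ => ?_)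
      have h3 := hS.shift σ
      rw [lt_iff_add_one_le] at h3
      refine coe_lt_of_le (le_val_mul (coeffHom_val hK hL (γ.coeff σ)) (le_val_pow h3 (p ^ j))) ?_
      have : (0 : ℤ) < (p ^ j : ℕ) := by exact_mod_cast pow_pos hp.out.pos j
      omega
    rw [hd]
    simp only
    rw [val_mul_eq h2 (val_inv_eq (val_pow_eq hS.val _))]
    congr 1; push_cast; ring
  have hjmem : p ^ j ∈ Finset.Ico 1 (p ^ n) :=
    Finset.mem_Ico.2 ⟨Nat.one_le_pow _ _ hp.out.pos, Nat.pow_lt_pow_right hp1 hj⟩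
  obtain ⟨k₁, hk₁, hmin⟩ := (Finset.Ico 1 (p ^ n)).exists_min_image (fun k => vL (d k)) ⟨_, hjmem⟩
  have hk₁0 : d k₁ ≠ 0 := by
    intro h
    have := hmin _ hjmem
    rw [h, hdj, vL.map_zero, top_le_iff] at this
    exact WithTop.coe_ne_top this
  obtain ⟨S, hS1⟩ := exists_val_eq vL hk₁0
  have hSle : S ≤ b * p ^ (n - 1) := by
    have h1 := hmin _ hjmem
    rw [hS1, hdj, WithTop.coe_le_coe] at h1
    refine h1.trans (mul_le_mul_of_nonneg_left ?_ hb.le)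
    exact pow_le_pow_right₀ (by exact_mod_cast hp1.le) (by omega)
  -- An index attaining the minimum satisfies `b * k ≤ S ≤ b * p ^ (n - 1)`. Two such indices lie
  -- between `1` and `p ^ (n - 1)` and are congruent modulo `p ^ (n - 1)`, because `b` is prime to
  -- `p`; so they coincide.
  have huniq : ∀ k ∈ Finset.Ico 1 (p ^ n), k ≠ k₁ → (S : WithTop ℤ) < vL (d k) := by
    intro k hk hne
    rw [← hS1]
    refine lt_of_le_of_ne (hmin k hk) fun he => hne ?_
    rw [hS1] at he
    obtain ⟨r, hr, hr'⟩ := hdval k S he.symm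
    obtain ⟨r₁, hr₁, hr₁'⟩ := hdval k₁ S hS1
    rw [Finset.mem_Ico] at hk hk₁
    have hP : (0 : ℤ) < p ^ (n - 1) := by positivity
    have hbd : ∀ (k : ℕ) (r : ℤ), 0 ≤ r → S = b * k + p ^ (n - 1) * r →
        (k : ℤ) ≤ p ^ (n - 1) := by
      intro k r hr hkr
      have : 0 ≤ p ^ (n - 1) * r := by positivity
      exact le_of_mul_le_mul_left (by linarith) hb
    have h1 := hbd k r hr hr'
    have h2 := hbd k₁ r₁ hr₁ hr₁'
    have h3 : (p : ℤ) ^ (n - 1) ∣ b * ((k : ℤ) - k₁) := ⟨r₁ - r, by linarith⟩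
    have h4 := Int.eq_zero_of_abs_lt_dvd ((hcop (n - 1)).dvd_of_dvd_mul_left h3) (by
      rw [abs_lt]; constructor <;> omega)
    omega
  have hd0 : d 0 = 0 := by simp only [hd, hD0, zero_mul]
  have hacti : ∀ i < p ^ n, act γ (Y ^ i) =
      Y ^ i * ∑ k ∈ Finset.range (p ^ n), (i.choose k : L) * d k := by
    intro i hi
    have h1 : ∀ σ : L ≃ₐ[K] L, σ (Y ^ i) =
        Y ^ i * ∑ k ∈ Finset.range (p ^ n), (i.choose k : L) * ((σ Y - Y) ^ k * (Y ^ k)⁻¹) := by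
      intro σ
      have h2 : σ (Y ^ i) = ((σ Y - Y) + Y) ^ i := by rw [sub_add_cancel, map_pow]
      rw [h2, add_pow, Finset.mul_sum]
      refine Finset.sum_subset_zero_on_sdiff (Finset.range_subset_range.2 (by omega)) ?_ ?_
      · intro k hk
        rw [Finset.mem_sdiff, Finset.mem_range, Finset.mem_range] at hk
        rw [Nat.choose_eq_zero_of_lt (by omega), Nat.cast_zero, zero_mul, mul_zero]
      · intro k hk
        rw [Finset.mem_range] at hk
        have h3 : Y ^ i = Y ^ (i - k) * Y ^ k := by rw [← pow_add, Nat.sub_add_cancel (by omega)]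
        have h4 : Y ^ k ≠ 0 := pow_ne_zero _ hY0
        rw [h3]
        field_simp
    rw [act_eq_sum]
    simp only [h1, Finset.mul_sum, hd, hD, Finset.sum_mul]
    rw [Finset.sum_comm]
    refine Finset.sum_congr rfl fun k _ => Finset.sum_congr rfl fun σ _ => by ring
  have hsumle : ∀ i : ℕ, (S : WithTop ℤ) ≤
      vL (∑ k ∈ Finset.range (p ^ n), (i.choose k : L) * d k) := by
    intro i
    refine vL.map_le_sum fun k hk => ?_
    rcases Nat.eq_zero_or_pos k with rfl | hk0
    · rw [hd0, mul_zero, vL.map_zero]; exact le_top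
    · have h1 := hmin k (Finset.mem_Ico.2 ⟨hk0, Finset.mem_range.1 hk⟩)
      rw [hS1] at h1
      have := le_val_mul (val_natCast_nonneg (v := vL) (i.choose k)) h1
      rwa [zero_add] at this
  have hNZ : (Module.finrank K L : ℤ) = ((p ^ n : ℕ) : ℤ) := by rw [hN]
  have hpn : 0 < p ^ n := pow_pos hp.out.pos n
  have hsumeq : vL (∑ k ∈ Finset.range (p ^ n), ((p ^ n - 1).choose k : L) * d k) =
      (S : WithTop ℤ) := by
    have hunit : ∀ k ∈ Finset.range (p ^ n), vL (((p ^ n - 1).choose k : L) * d k) = vL (d k) := by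
      intro k hk
      rw [choose_pow_sub_one p n k (Finset.mem_range.1 hk), vL.map_mul, vL.map_pow, vL.map_neg,
        vL.map_one, nsmul_zero, zero_add]
    rw [Finset.mem_Ico] at hk₁
    refine val_sum_eq_of_lt (Finset.mem_range.2 hk₁.2) ?_ fun k hk hne => ?_
    · rw [hunit _ (Finset.mem_range.2 hk₁.2), hS1]
    · rw [hunit k hk]
      rcases Nat.eq_zero_or_pos k with rfl | hk0
      · rw [hd0, vL.map_zero]; exact WithTop.coe_lt_top _
      · exact huniq k (Finset.mem_Ico.2 ⟨hk0, Finset.mem_range.1 hk⟩) hne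
  have hcopN : IsCoprime (-b) (Module.finrank K L : ℤ) := by
    rw [hN, Nat.cast_pow]
    exact (hcop n).symm.neg_left
  refine ⟨S, ?_, hSle, ?_, ?_⟩
  · obtain ⟨r, hr, hr'⟩ := hdval k₁ S hS1
    rw [hr']
    positivity
  · intro x m hx
    obtain ⟨e, he1, he2, -⟩ := exists_power_expansion hL hS.val hcopN (u := 1) (t := 0)
      (by simp) x
    simp only [mul_one] at he1 he2
    rw [he1, act_sum_smul]
    refine vL.map_le_sum fun i _ => ?_
    rw [hacti i (by have := i.2; omega), ← smul_mul_assoc]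
    exact le_val_mul (hx.trans (he2 i)) (hsumle i)
  · intro x m hx hmod
    obtain ⟨e, he1, -, he3⟩ := exists_power_expansion hL hS.val hcopN (u := 1) (t := 0)
      (by simp) x
    simp only [mul_one] at he1 he3
    have he4 := he3 m hx
    rw [he1, act_sum_smul]
    -- When the valuation of `x` is congruent to `b`, the term with exponent `p ^ n - 1` is the
    -- unique one of least valuation. It is shifted by exactly `S` and all others by at least `S`.
    refine val_sum_eq_of_lt (i := ⟨p ^ n - 1, by omega⟩) (Finset.mem_univ _) ?_ fun i _ hne => ?_
    · rw [hacti _ (by simp only; omega), ← smul_mul_assoc]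
      refine val_mul_eq ((he4 _).1 ?_) hsumeq
      refine Int.ModEq.trans ?_ (hNZ ▸ hmod.symm)
      refine Int.modEq_iff_dvd.2 ⟨b, ?_⟩
      simp only
      rw [hNZ, Nat.cast_sub hpn]
      push_cast; ring
    · have hi := i.2
      rw [hacti i (by omega), ← smul_mul_assoc]
      have h5 := (he4 i).2 (by
        intro h
        rw [hNZ] at h
        have h6 := Int.modEq_iff_dvd.1 (h.trans hmod)
        have h7 : ((p ^ n : ℕ) : ℤ) ∣ b * ((i : ℤ) + 1) := by
          convert h6 using 1; ring
        rw [Nat.cast_pow] at h7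
        have h8 := Int.le_of_dvd (by positivity) ((hcop n).dvd_of_dvd_mul_left h7)
        refine hne (Fin.ext ?_)
        simp only
        have : p ^ n ≤ (i : ℕ) + 1 := by exact_mod_cast h8
        omega)
      rw [lt_iff_add_one_le] at h5 ⊢
      convert le_val_mul h5 (hsumle i) using 2
      ring

end IsScaffold

end Shift

/-! ### Newton interpolation with truncated binomials. -/

section Newton

variable {F : Type*} [Field F] (p : ℕ) [hp : Fact p.Prime] [CharP F p]

lemma factorial_ne_zero_of_lt {i : ℕ} (hi : i < p) : ((i ! : ℕ) : F) ≠ 0 := by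
  rw [Ne, CharP.cast_eq_zero_iff F p, hp.out.dvd_factorial]
  omega

lemma binom_natCast (m : ℕ) {i : ℕ} (hi : i < p) : binom (m : F) i = (m.choose i : F) := by
  have h1 : ∀ k : ℕ, ∏ j ∈ Finset.range k, ((m : F) - (j : F)) = (m.descFactorial k : F) := by
    intro k
    induction k with
    | zero => simp
    | succ k ih =>
      rw [Finset.prod_range_succ, ih, Nat.descFactorial_succ]
      rcases le_or_gt k m with h | h
      · push_cast [h]; ring
      · rw [Nat.descFactorial_eq_zero_iff_lt.2 h]; simp
  rw [binom, h1, Nat.descFactorial_eq_factorial_mul_choose, Nat.cast_mul,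
    mul_div_cancel_left₀ _ (factorial_ne_zero_of_lt p hi)]

/-- Newton's interpolation formula for polynomials of degree less than `p`. -/
lemma sum_binom_mul_fwdDiff (h : Polynomial F) (hh : h.natDegree < p) (w : F) :
    ∑ i ∈ Finset.range p, binom w i * (fwdDiff (1 : F))^[i] (fun s => h.eval s) 0 = h.eval w := by
  set d : ℕ → F := fun i => (fwdDiff (1 : F))^[i] (fun s => h.eval s) 0 with hd
  set N : Polynomial F := ∑ i ∈ Finset.range p, Polynomial.C (d i / ((i ! : ℕ) : F)) *
    ∏ j ∈ Finset.range i, (Polynomial.X - Polynomial.C (j : F)) with hNdef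
  have hNeval : ∀ w, N.eval w = ∑ i ∈ Finset.range p, binom w i * d i := by
    intro w
    rw [hNdef, Polynomial.eval_finsetSum]
    refine Finset.sum_congr rfl fun i _ => ?_
    rw [Polynomial.eval_mul, Polynomial.eval_C, Polynomial.eval_prod, binom]
    simp only [Polynomial.eval_sub, Polynomial.eval_X, Polynomial.eval_C]
    ring
  have hNdeg : (N - h).natDegree < p := by
    refine lt_of_le_of_lt (Polynomial.natDegree_sub_le_of_le (n := p - 1) ?_ (by omega))
      (by have := hp.out.pos; rw [max_self]; omega)
    refine Polynomial.natDegree_sum_le_of_forall_le _ _ fun i hi => ?_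
    rw [Finset.mem_range] at hi
    refine (Polynomial.natDegree_C_mul_le _ _).trans ?_
    refine (Polynomial.natDegree_prod_le _ _).trans ?_
    simp only [Polynomial.natDegree_X_sub_C, Finset.sum_const, Finset.card_range, smul_eq_mul]
    omega
  -- At a natural number `m < p` the interpolant is the finite difference expansion of `h`. A
  -- polynomial of degree less than `p` with these `p` zeros vanishes.
  have hpts : ∀ m : Fin p, (N - h).eval ((m : ℕ) : F) = 0 := by
    intro m
    rw [Polynomial.eval_sub, hNeval, sub_eq_zero]
    have h1 := shift_eq_sum_fwdDiff_iter (1 : F) (fun s => h.eval s) (m : ℕ) 0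
    rw [zero_add, nsmul_eq_mul, mul_one] at h1
    rw [h1]
    have h2 : ∀ i ∈ Finset.range p, binom ((m : ℕ) : F) i * d i = ((m : ℕ).choose i) • d i := by
      intro i hi
      rw [binom_natCast p _ (Finset.mem_range.1 hi), nsmul_eq_mul]
    rw [Finset.sum_congr rfl h2]
    refine (Finset.sum_subset (Finset.range_subset_range.2 (by have := m.2; omega)) ?_).symm
    intro i _ hi
    rw [Finset.mem_range] at hi
    rw [Nat.choose_eq_zero_of_lt (by omega), zero_smul]
  have hinj : Function.Injective fun m : Fin p => ((m : ℕ) : F) := by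
    intro m m' hmm
    have := CharP.natCast_injOn_Iio F p (Set.mem_Iio.2 m.2) (Set.mem_Iio.2 m'.2) hmm
    exact Fin.ext this
  have hzero := Polynomial.eq_zero_of_natDegree_lt_card_of_eval_eq_zero (N - h) hinj hpts (by
    rwa [Fintype.card_fin])
  rw [← hNeval, sub_eq_zero.1 hzero]

end Newton

/-! ### Translating polynomials and restricting them to lines. -/

section Polynomials

variable {F : Type*} [Field F] {n : ℕ}

/-- Products in the group ring correspond to translations of points, so the degree must not grow
under translation. -/
lemma exists_translate (P : MvPolynomial (Fin n) F) (v : Fin n → F) :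
    ∃ Q : MvPolynomial (Fin n) F, Q.totalDegree ≤ P.totalDegree ∧
      ∀ t, MvPolynomial.eval t Q = MvPolynomial.eval (v + t) P := by
  refine ⟨∑ d ∈ P.support, MvPolynomial.C (P.coeff d) *
    ∏ i, (MvPolynomial.X i + MvPolynomial.C (v i)) ^ d i, ?_, fun t => ?_⟩
  · refine MvPolynomial.totalDegree_finsetSum_le fun d hd => ?_
    refine (MvPolynomial.totalDegree_mul _ _).trans ?_
    rw [MvPolynomial.totalDegree_C, zero_add]
    refine (MvPolynomial.totalDegree_finsetProd _ _).trans
      (le_trans ?_ (MvPolynomial.le_totalDegree hd))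
    rw [Finsupp.sum_fintype _ _ fun _ => rfl]
    refine Finset.sum_le_sum fun i _ => (MvPolynomial.totalDegree_pow _ _).trans ?_
    refine mul_le_of_le_one_right (Nat.zero_le _) ((MvPolynomial.totalDegree_add _ _).trans ?_)
    rw [MvPolynomial.totalDegree_X, MvPolynomial.totalDegree_C]
    simp
  · rw [MvPolynomial.eval_eq' (v + t) P, map_sum]
    refine Finset.sum_congr rfl fun d _ => ?_
    simp only [map_mul, MvPolynomial.eval_C, map_prod, map_pow, map_add, MvPolynomial.eval_X,
      Pi.add_apply, add_comm (t _)]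

/-- Truncated powers move a point along its line through the origin, which reduces their study to
one variable. -/
lemma exists_restrict_line (P : MvPolynomial (Fin n) F) (u : Fin n → F) :
    ∃ h : Polynomial F, h.natDegree ≤ P.totalDegree ∧
      ∀ s, h.eval s = MvPolynomial.eval (s • u) P := by
  refine ⟨∑ d ∈ P.support, Polynomial.C (P.coeff d) *
    ∏ i, (Polynomial.C (u i) * Polynomial.X) ^ d i, ?_, fun s => ?_⟩
  · refine Polynomial.natDegree_sum_le_of_forall_le _ _ fun d hd => ?_
    refine (Polynomial.natDegree_C_mul_le _ _).trans ((Polynomial.natDegree_prod_le _ _).trans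
      (le_trans ?_ (MvPolynomial.le_totalDegree hd)))
    rw [Finsupp.sum_fintype _ _ fun _ => rfl]
    refine Finset.sum_le_sum fun i _ => Polynomial.natDegree_pow_le.trans ?_
    exact mul_le_of_le_one_right (Nat.zero_le _) ((Polynomial.natDegree_C_mul_le _ _).trans
      Polynomial.natDegree_X_le)
  · rw [MvPolynomial.eval_eq', Polynomial.eval_finsetSum]
    refine Finset.sum_congr rfl fun d _ => ?_
    simp only [Polynomial.eval_mul, Polynomial.eval_C, Polynomial.eval_prod, Polynomial.eval_pow,
      Polynomial.eval_X, Pi.smul_apply, smul_eq_mul, mul_comm s]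

end Polynomials

/-! ### The pairing of the group ring with functions. -/

section Pairing

variable {F G : Type*} [Field F] [Group G] [Fintype G]

/-- The pairing of the group ring with functions on the group. -/
def pairing (ψ : G → F) : MonoidAlgebra F G →ₗ[F] F where
  toFun γ := ∑ σ, γ.coeff σ * ψ σ
  map_add' γ δ := by
    simp only [MonoidAlgebra.coeff_add, Finsupp.add_apply, add_mul, Finset.sum_add_distrib]
  map_smul' r γ := by
    simp only [MonoidAlgebra.coeff_smul, Finsupp.smul_apply, smul_eq_mul, RingHom.id_apply,
      Finset.mul_sum, mul_assoc]

lemma pairing_apply (ψ : G → F) (γ : MonoidAlgebra F G) :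
    pairing ψ γ = ∑ σ, γ.coeff σ * ψ σ := rfl

lemma pairing_of (ψ : G → F) (σ : G) : pairing ψ (MonoidAlgebra.of F G σ) = ψ σ := by
  classical
  rw [pairing_apply, Finset.sum_eq_single σ]
  · simp
  · intro τ _ h
    simp [Finsupp.single_apply, h.symm]
  · simp

lemma eq_sum_of (γ : MonoidAlgebra F G) : γ = ∑ σ, γ.coeff σ • MonoidAlgebra.of F G σ := by
  classical
  ext τ
  simp [MonoidAlgebra.coeff_sum]

lemma pairing_mul (ψ : G → F) (γ δ : MonoidAlgebra F G) :
    pairing ψ (γ * δ) = ∑ σ, γ.coeff σ * pairing (fun τ => ψ (σ * τ)) δ := by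
  have h : ∀ σ, pairing (fun τ => ψ (σ * τ)) δ = ∑ τ, δ.coeff τ * ψ (σ * τ) := fun _ => rfl
  conv_lhs => rw [eq_sum_of γ, eq_sum_of δ]
  simp only [h, Finset.sum_mul, Finset.mul_sum, smul_mul_smul_comm, ← map_mul, map_sum, map_smul,
    pairing_of, smul_eq_mul, mul_assoc]
  exact Finset.sum_comm

lemma lift_one_eq_pairing (γ : MonoidAlgebra F G) :
    MonoidAlgebra.lift F F G (1 : G →* F) γ = pairing (fun _ => 1) γ := by
  rw [MonoidAlgebra.lift_apply, pairing_apply, Finsupp.sum_fintype _ _ fun σ => by simp]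
  simp

end Pairing

/-! ### Powers of the augmentation ideal as annihilators of polynomials. -/

section Annihilator

variable {F G : Type*} [Field F] [CommGroup G] [Fintype G] (p : ℕ) [hp : Fact p.Prime]
  [CharP F p] {n : ℕ} {a : G → Fin n → ZMod p}

/-- An element of the group ring of `(ZMod p)^n` on which all polynomial functions of degree less
than `k` vanish lies in the `k`-th power of the augmentation ideal. -/
lemma mem_pow_of_pairing_eq_zero (ha : Function.Bijective a)
    (hmul : ∀ σ τ, a (σ * τ) = a σ + a τ) (γ : MonoidAlgebra F G) (k : ℕ)
    (h : ∀ α : Fin n → ℕ, (∀ i, α i < p) → ∑ i, α i < k →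
      pairing (fun σ => ∏ i, binom (ZMod.castHom (dvd_refl p) F (a σ i)) (α i)) γ = 0) :
    γ ∈ RingHom.ker (MonoidAlgebra.lift F F G (1 : G →* F)) ^ k := by
  classical
  set A : Ideal (MonoidAlgebra F G) := RingHom.ker (MonoidAlgebra.lift F F G (1 : G →* F))
  choose g hg using fun i : Fin n => ha.2 (Pi.single i 1)
  set X : Fin n → MonoidAlgebra F G := fun i => MonoidAlgebra.of F G (g i) - 1 with hX
  have hXA : ∀ i, X i ∈ A := fun i => by
    rw [RingHom.mem_ker, hX, map_sub, MonoidAlgebra.lift_of, MonoidHom.one_apply, map_one, sub_self]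
  let ahom : G →* Multiplicative (Fin n → ZMod p) :=
    { toFun := fun σ => Multiplicative.ofAdd (a σ)
      map_one' := by
        have h1 : a 1 = 0 := by simpa using hmul 1 1
        rw [h1]; rfl
      map_mul' := fun σ τ => by rw [hmul]; rfl }
  have hdecomp : ∀ σ, σ = ∏ i, g i ^ (a σ i).val := by
    intro σ
    apply ha.1
    have h1 : Multiplicative.ofAdd (a (∏ i, g i ^ (a σ i).val)) =
        ∏ i, Multiplicative.ofAdd (a (g i)) ^ (a σ i).val := by
      change ahom _ = ∏ i, ahom (g i) ^ _
      rw [map_prod]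
      simp only [map_pow]
    have h2 : a (∏ i, g i ^ (a σ i).val) = ∑ i, (a σ i).val • a (g i) := by
      apply Multiplicative.ofAdd.injective
      rw [h1, ofAdd_sum]
      simp only [ofAdd_nsmul]
    rw [h2]
    funext j
    rw [Finset.sum_apply, Finset.sum_eq_single j]
    · rw [hg, Pi.smul_apply, Pi.single_eq_same, nsmul_eq_mul, mul_one, ZMod.natCast_zmod_val]
    · intro i _ hij
      rw [hg, Pi.smul_apply, Pi.single_eq_of_ne hij.symm, smul_zero]
    · simp
  have hbin : ∀ t : ZMod p, ∀ i ∈ Finset.range p, (t.val.choose i : F) =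
      binom (ZMod.castHom (dvd_refl p) F t) i := by
    intro t i hi
    rw [← binom_natCast p t.val (Finset.mem_range.1 hi)]
    congr 1
    conv_rhs => rw [← ZMod.natCast_zmod_val t, map_natCast]
  -- Write `σ` as a product of the `(1 + X i) ^ a σ i`. The coefficients of `γ` on the monomials in
  -- the `X i` are then its pairings with products of binomials, and only monomials of degree at
  -- least `k` survive.
  have hof : ∀ σ, MonoidAlgebra.of F G σ = ∑ α ∈ Fintype.piFinset fun _ : Fin n => Finset.range p,
      (∏ i, binom (ZMod.castHom (dvd_refl p) F (a σ i)) (α i)) • ∏ i, X i ^ α i := by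
    intro σ
    conv_lhs => rw [hdecomp σ]
    rw [map_prod]
    have h1 : ∀ i, MonoidAlgebra.of F G (g i ^ (a σ i).val) = ∑ j ∈ Finset.range p,
        binom (ZMod.castHom (dvd_refl p) F (a σ i)) j • X i ^ j := by
      intro i
      have h2 : MonoidAlgebra.of F G (g i) = X i + 1 := by rw [hX]; simp only; ring
      rw [map_pow, h2, add_pow]
      have h3 : ∀ j ∈ Finset.range p, binom (ZMod.castHom (dvd_refl p) F (a σ i)) j • X i ^ j =
          X i ^ j * 1 ^ ((a σ i).val - j) * ((a σ i).val.choose j : MonoidAlgebra F G) := by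
        intro j hj
        rw [← hbin _ j hj, one_pow, mul_one, mul_comm, Nat.cast_smul_eq_nsmul, nsmul_eq_mul]
      rw [Finset.sum_congr rfl h3]
      refine Finset.sum_subset (Finset.range_subset_range.2 (ZMod.val_lt _)) ?_
      intro j _ hj
      rw [Finset.mem_range] at hj
      rw [Nat.choose_eq_zero_of_lt (by omega), Nat.cast_zero, mul_zero]
    rw [Finset.prod_congr rfl fun i _ => h1 i, Finset.prod_univ_sum]
    refine Finset.sum_congr rfl fun α _ => ?_
    rw [Finset.prod_smul]
  have hγ : γ = ∑ α ∈ Fintype.piFinset fun _ : Fin n => Finset.range p,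
      pairing (fun σ => ∏ i, binom (ZMod.castHom (dvd_refl p) F (a σ i)) (α i)) γ •
        ∏ i, X i ^ α i := by
    conv_lhs => rw [eq_sum_of γ]
    simp only [pairing_apply, hof, Finset.smul_sum, Finset.sum_smul, smul_smul]
    exact Finset.sum_comm
  rw [hγ]
  refine Ideal.sum_mem _ fun α hα => ?_
  have hα' : ∀ i, α i < p := fun i => Finset.mem_range.1 (Fintype.mem_piFinset.1 hα i)
  by_cases hk : ∑ i, α i < k
  · rw [h α hα' hk, zero_smul]
    exact Ideal.zero_mem _
  · refine Submodule.smul_of_tower_mem _ _ ?_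
    refine Ideal.pow_le_pow_right (not_lt.1 hk) ?_
    rw [← Finset.prod_pow_eq_pow_sum]
    exact Ideal.prod_mem_prod fun i _ => Ideal.pow_mem_pow (hXA i) _

end Annihilator

/-! ### Elements of the span as points of `F ^ n`. -/

section Span

variable {F K L : Type*} [Field F] [Field K] [Field L] [Algebra F K] [Algebra K L]
  [FiniteDimensional K L] (p : ℕ) [hp : Fact p.Prime] [CharP F p] {n : ℕ}
  {a : (L ≃ₐ[K] L) → Fin n → ZMod p}

lemma mem_augIdeal_iff (γ : GroupRing F K L) :
    γ ∈ augIdeal F K L ↔ pairing (fun _ => (1 : F)) γ = 0 := by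
  rw [RingHom.mem_ker, ← lift_one_eq_pairing]

lemma mem_augIdeal_pow_of_pairing_eq_zero (ha : Function.Bijective a)
    (hmul : ∀ σ τ, a (σ * τ) = a σ + a τ) (γ : GroupRing F K L) (k : ℕ)
    (h : ∀ α : Fin n → ℕ, (∀ i, α i < p) → ∑ i, α i < k →
      pairing (fun σ => ∏ i, binom (ZMod.castHom (dvd_refl p) F (a σ i)) (α i)) γ = 0) :
    γ ∈ augIdeal F K L ^ k := by
  let _ : CommGroup (L ≃ₐ[K] L) :=
    { (inferInstance : Group (L ≃ₐ[K] L)) with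
      mul_comm := fun σ τ => ha.1 (by rw [hmul, hmul, add_comm]) }
  exact mem_pow_of_pairing_eq_zero p ha hmul γ k h

/-- The point of `F ^ n` attached to an automorphism. -/
def galoisPoint (a : (L ≃ₐ[K] L) → Fin n → ZMod p) (σ : L ≃ₐ[K] L) : Fin n → F :=
  fun i => ZMod.castHom (dvd_refl p) F (a σ i)

/-- An element of the group ring represents the point `u` up to degree `k` if its pairing with
polynomial functions of degree less than `k` is the evaluation at `u`. -/
def Represents (a : (L ≃ₐ[K] L) → Fin n → ZMod p) (k : ℕ) (γ : GroupRing F K L)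
    (u : Fin n → F) : Prop :=
  ∀ P : MvPolynomial (Fin n) F, P.totalDegree < k →
    pairing (fun σ => MvPolynomial.eval (galoisPoint p a σ) P) γ = MvPolynomial.eval u P

variable {p}

lemma galoisPoint_mul (hmul : ∀ σ τ, a (σ * τ) = a σ + a τ) (σ τ : L ≃ₐ[K] L) :
    galoisPoint (F := F) p a (σ * τ) = galoisPoint p a σ + galoisPoint p a τ := by
  funext i
  simp only [galoisPoint, hmul, Pi.add_apply, map_add]

lemma represents_of (σ : L ≃ₐ[K] L) (k : ℕ) :
    Represents p a k (MonoidAlgebra.of F (L ≃ₐ[K] L) σ) (galoisPoint p a σ) := fun P _ => by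
  rw [pairing_of]

/-- The group acts on points by translation, so pairing with a product evaluates in one factor at a
time, each time on a translate of the same degree bound. -/
lemma Represents.mul (hmul : ∀ σ τ, a (σ * τ) = a σ + a τ) {k : ℕ} {γ δ : GroupRing F K L}
    {u v : Fin n → F} (hγ : Represents p a k γ u) (hδ : Represents p a k δ v) :
    Represents p a k (γ * δ) (u + v) := by
  intro P hP
  rw [pairing_mul]
  obtain ⟨Q, hQ, hQ'⟩ := exists_translate P v
  have h1 : ∀ σ, pairing (fun τ => MvPolynomial.eval (galoisPoint p a (σ * τ)) P) δ =
      MvPolynomial.eval (galoisPoint p a σ) Q := by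
    intro σ
    obtain ⟨R, hR, hR'⟩ := exists_translate P (galoisPoint p a σ)
    simp only [galoisPoint_mul hmul, ← hR']
    rw [hδ R (lt_of_le_of_lt hR hP), hR', hQ', add_comm]
  simp only [h1]
  exact (hγ Q (lt_of_le_of_lt hQ hP)).trans (by rw [hQ', add_comm])

lemma represents_one (hmul : ∀ σ τ, a (σ * τ) = a σ + a τ) (k : ℕ) :
    Represents p a k (1 : GroupRing F K L) 0 := by
  have h1 : a 1 = 0 := by simpa using hmul 1 1
  have h2 := represents_of (F := F) (p := p) (a := a) 1 k
  have h3 : galoisPoint (F := F) p a 1 = 0 := by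
    funext i
    simp only [galoisPoint, h1, Pi.zero_apply, map_zero]
  rwa [map_one, h3] at h2

lemma Represents.pow (hmul : ∀ σ τ, a (σ * τ) = a σ + a τ) {k : ℕ} {γ : GroupRing F K L}
    {u : Fin n → F} (hγ : Represents p a k γ u) (j : ℕ) :
    Represents p a k (γ ^ j) ((j : F) • u) := by
  induction j with
  | zero => simpa using represents_one hmul k
  | succ j ih =>
    rw [pow_succ]
    convert ih.mul hmul hγ using 1
    push_cast
    rw [add_smul, one_smul]

/-- Since `γ ^ j` represents `j • u`, pairing `(γ - 1) ^ i` with `P` gives the `i`-th forward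
difference at `0` of `s ↦ P (s • u)`. Newton's formula sums these to the value at `w`; it applies
because the degree is less than `k ≤ p`. -/
lemma Represents.truncPow (hmul : ∀ σ τ, a (σ * τ) = a σ + a τ) {k : ℕ} (hk : k ≤ p)
    {γ : GroupRing F K L} {u : Fin n → F} (hγ : Represents p a k γ u) (w : F) :
    Represents p a k (truncPow p γ w) (w • u) := by
  intro P hP
  obtain ⟨h, hh, hh'⟩ := exists_restrict_line P u
  rw [← hh', ← sum_binom_mul_fwdDiff p h (by omega) w, RefinedBreaks.truncPow, map_sum]
  refine Finset.sum_congr rfl fun i _ => ?_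
  rw [map_smul, smul_eq_mul]
  congr 1
  rw [fwdDiff_iter_eq_sum_shift, sub_eq_add_neg, (Commute.neg_one_right γ).add_pow, map_sum]
  refine Finset.sum_congr rfl fun j _ => ?_
  have h1 : γ ^ j * (-1) ^ (i - j) * (i.choose j : GroupRing F K L) =
      ((-1 : F) ^ (i - j) * (i.choose j : F)) • γ ^ j := by
    rw [← Nat.cast_comm, ← mul_assoc]
    rcases Nat.even_or_odd (i - j) with he | ho
    · rw [he.neg_one_pow, he.neg_one_pow, one_mul, mul_one, Nat.cast_smul_eq_nsmul, nsmul_eq_mul]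
    · rw [ho.neg_one_pow, ho.neg_one_pow, mul_neg_one, neg_one_mul, neg_smul,
        Nat.cast_smul_eq_nsmul, nsmul_eq_mul]
  rw [h1, map_smul, hγ.pow hmul j P hP, ← hh', zero_add, nsmul_eq_mul, mul_one, smul_eq_mul,
    zsmul_eq_mul]
  push_cast
  ring

lemma GSpan.exists_represents (hmul : ∀ σ τ, a (σ * τ) = a σ + a τ) {k : ℕ} (hk : k ≤ p)
    {c : QuotRing F K L k} (hc : GSpan p k c) :
    ∃ (γ : GroupRing F K L) (u : Fin n → F), Ideal.Quotient.mk (augIdeal F K L ^ k) γ = c ∧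
      Represents p a k γ u := by
  induction hc with
  | of σ => exact ⟨_, _, rfl, represents_of σ k⟩
  | add _ _ h1 h2 =>
    obtain ⟨γ, u, rfl, hγ⟩ := h1
    obtain ⟨δ, v, rfl, hδ⟩ := h2
    exact ⟨γ * δ, u + v, map_mul _ _ _, hγ.mul hmul hδ⟩
  | smul w _ h1 =>
    obtain ⟨γ, u, rfl, hγ⟩ := h1
    refine ⟨RefinedBreaks.truncPow p γ w, w • u, ?_, hγ.truncPow hmul hk w⟩
    simp only [RefinedBreaks.truncPow, map_sum]
    refine Finset.sum_congr rfl fun i _ => ?_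
    rw [← map_one (Ideal.Quotient.mk (augIdeal F K L ^ k)), ← map_sub, ← map_pow]
    rfl

/-- On a product of two elements, an additive function behaves as a derivation: each resulting term
carries the augmentation of one factor, which is `0`. -/
lemma pairing_eq_zero_of_mem_sq {l : (L ≃ₐ[K] L) → F} (hl : ∀ σ τ, l (σ * τ) = l σ + l τ)
    {γ : GroupRing F K L} (hγ : γ ∈ augIdeal F K L ^ 2) : pairing l γ = 0 := by
  rw [Submodule.pow_succ, Submodule.pow_one] at hγ
  refine Submodule.mul_induction_on hγ (fun x hx y hy => ?_) fun x y hx hy => ?_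
  · rw [mem_augIdeal_iff] at hx hy
    rw [pairing_mul]
    have h1 : ∀ σ, pairing (fun τ => l (σ * τ)) y = pairing l y := by
      intro σ
      rw [pairing_apply] at hy
      simp only [mul_one] at hy
      simp only [pairing_apply, hl, mul_add, Finset.sum_add_distrib, ← Finset.sum_mul, hy,
        zero_mul, zero_add]
    simp only [h1, ← Finset.sum_mul]
    rw [pairing_apply] at hx
    simp only [mul_one] at hx
    rw [hx, zero_mul]
  · rw [map_add, hx, hy, add_zero]

lemma exists_eval_eq_prod_binom (α : Fin n → ℕ) :
    ∃ P : MvPolynomial (Fin n) F, P.totalDegree ≤ ∑ i, α i ∧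
      ∀ t, MvPolynomial.eval t P = ∏ i, binom (t i) (α i) := by
  refine ⟨∏ i, (MvPolynomial.C (((α i) ! : ℕ) : F)⁻¹ *
    ∏ j ∈ Finset.range (α i), (MvPolynomial.X i - MvPolynomial.C (j : F))), ?_, fun t => ?_⟩
  · refine (MvPolynomial.totalDegree_finsetProd _ _).trans (Finset.sum_le_sum fun i _ => ?_)
    refine (MvPolynomial.totalDegree_mul _ _).trans ?_
    rw [MvPolynomial.totalDegree_C, zero_add]
    refine (MvPolynomial.totalDegree_finsetProd _ _).trans ?_
    refine (Finset.sum_le_card_nsmul _ _ 1 fun j _ => ?_).trans (by simp)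
    refine (MvPolynomial.totalDegree_sub _ _).trans ?_
    rw [MvPolynomial.totalDegree_X, MvPolynomial.totalDegree_C]
    simp
  · simp only [map_prod, map_mul, map_sub, MvPolynomial.eval_X, MvPolynomial.eval_C, binom]
    exact Finset.prod_congr rfl fun i _ => by ring

/-- Nontrivial elements of the span of the Galois group differ from `1` by elements outside the
square of the augmentation ideal. -/
lemma GSpan.sub_one_mem (ha : Function.Bijective a) (hmul : ∀ σ τ, a (σ * τ) = a σ + a τ) {k : ℕ}
    (hk2 : 2 ≤ k) (hk : k ≤ p) {c : QuotRing F K L k} (hc : GSpan p k c) (hc1 : c ≠ 1)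
    {γ : GroupRing F K L} (hγ : Ideal.Quotient.mk (augIdeal F K L ^ k) γ = c) :
    γ - 1 ∈ augIdeal F K L ∧ γ - 1 ∉ augIdeal F K L ^ 2 := by
  obtain ⟨δ, u, hδ, hδu⟩ := hc.exists_represents hmul hk
  have hone := represents_one (F := F) hmul k
  have hdiff : γ - δ ∈ augIdeal F K L ^ k := by
    rw [← Ideal.Quotient.eq, hγ, hδ]
  have hle2 : augIdeal F K L ^ k ≤ augIdeal F K L ^ 2 := Ideal.pow_le_pow_right hk2
  have hle1 : augIdeal F K L ^ k ≤ augIdeal F K L := Ideal.pow_le_self (by omega)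
  have hδ1 : δ - 1 ∈ augIdeal F K L := by
    rw [mem_augIdeal_iff, map_sub]
    have h1 := hδu 1 (by rw [MvPolynomial.totalDegree_one]; omega)
    have h2 := hone 1 (by rw [MvPolynomial.totalDegree_one]; omega)
    simp only [map_one] at h1 h2
    rw [h1, h2, sub_self]
  constructor
  · have := Ideal.add_mem _ (hle1 hdiff) hδ1
    rwa [sub_add_sub_cancel] at this
  · intro hsq
    have hδsq : δ - 1 ∈ augIdeal F K L ^ 2 := by
      have := Ideal.sub_mem _ hsq (hle2 hdiff)
      rwa [show γ - 1 - (γ - δ) = δ - 1 by abel] at this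
    -- The coordinate functions are additive, hence vanish on `A ^ 2`. So `δ` represents the same
    -- point as `1`, and `δ - 1` is annihilated by all polynomials of degree less than `k`.
    have hu : u = 0 := by
      funext i
      have h1 := hδu (MvPolynomial.X i) (by rw [MvPolynomial.totalDegree_X]; omega)
      have h2 := hone (MvPolynomial.X i) (by rw [MvPolynomial.totalDegree_X]; omega)
      have h3 := pairing_eq_zero_of_mem_sq
        (l := fun σ => MvPolynomial.eval (galoisPoint p a σ) (MvPolynomial.X i))
        (fun σ τ => by simp only [galoisPoint_mul hmul, MvPolynomial.eval_X, Pi.add_apply]) hδsq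
      rw [map_sub, h1, h2, MvPolynomial.eval_X, MvPolynomial.eval_X, Pi.zero_apply, sub_zero] at h3
      exact h3
    refine hc1 ?_
    rw [← hδ, ← map_one (Ideal.Quotient.mk (augIdeal F K L ^ k)), Ideal.Quotient.eq]
    refine mem_augIdeal_pow_of_pairing_eq_zero p ha hmul _ k fun α _ hα => ?_
    obtain ⟨P, hP, hP'⟩ := exists_eval_eq_prod_binom (F := F) α
    have h1 := hδu P (by omega)
    have h2 := hone P (by omega)
    simp only [hP', galoisPoint] at h1 h2
    rw [map_sub, h1, h2, hu, sub_self]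

/-- The products of binomials of degree less than `2` are the constant `1` and the coordinates, and
the constant already vanishes on `A`. -/
lemma exists_pairing_ne_zero (ha : Function.Bijective a) (hmul : ∀ σ τ, a (σ * τ) = a σ + a τ)
    {γ : GroupRing F K L} (h1 : γ ∈ augIdeal F K L) (h2 : γ ∉ augIdeal F K L ^ 2) :
    ∃ i, pairing (fun σ => ZMod.castHom (dvd_refl p) F (a σ i)) γ ≠ 0 := by
  by_contra hall
  push Not at hall
  refine h2 (mem_augIdeal_pow_of_pairing_eq_zero p ha hmul γ 2 fun α _ hα => ?_)
  have hb0 : ∀ t : F, binom t 0 = 1 := fun t => by simp [binom]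
  have hb1 : ∀ t : F, binom t 1 = t := fun t => by simp [binom]
  by_cases h0 : ∃ i, α i ≠ 0
  · obtain ⟨i, hi⟩ := h0
    have hle := Finset.sum_eq_sum_sdiff_singleton_add (Finset.mem_univ i) α
    have hrest : ∀ j, j ≠ i → α j = 0 := by
      intro j hj
      have : ∑ x ∈ Finset.univ \ {i}, α x = 0 := by omega
      exact (Finset.sum_eq_zero_iff.1 this) j (by simp [hj])
    have hi1 : α i = 1 := by omega
    have : ∀ σ, ∏ j, binom (ZMod.castHom (dvd_refl p) F (a σ j)) (α j) =
        ZMod.castHom (dvd_refl p) F (a σ i) := by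
      intro σ
      rw [Finset.prod_eq_single i]
      · rw [hi1, hb1]
      · intro j _ hj
        rw [hrest j hj, hb0]
      · simp
    simp only [this]
    exact hall i
  · push Not at h0
    simp only [h0, hb0, Finset.prod_const_one]
    exact (mem_augIdeal_iff γ).1 h1

end Span

/-! ### The different and valuation criterion elements. -/

section Different

variable {F K L : Type*} [Field F] [Field K] [Field L] [Algebra F K] [Algebra K L]
  [FiniteDimensional K L] [IsGalois K L] {p : ℕ} [hp : Fact p.Prime] [CharP F p]
  {vK : AddValuation K (WithTop ℤ)} {vL : AddValuation L (WithTop ℤ)}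
  {n : ℕ} {b : ℤ} {Y : L} {a : (L ≃ₐ[K] L) → Fin n → ZMod p} {c : Fin n → F} {i₀ : Fin n}

omit [Field F] [Algebra F K] [FiniteDimensional K L] [IsGalois K L] in
lemma IsDifferentExponent.unique (hL : IsTotallyRamified vK vL) {d d' : ℤ}
    (h : IsDifferentExponent vK vL d) (h' : IsDifferentExponent vK vL d') : d = d' := by
  have key : ∀ {d d' : ℤ}, IsDifferentExponent vK vL d → IsDifferentExponent vK vL d' → d ≤ d' := by
    intro d d' h h'
    obtain ⟨x, hx⟩ := hL.normalized ((-d : ℤ) : WithTop ℤ)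
    have := (h' x).1 ((h x).2 hx.ge)
    rw [hx, WithTop.coe_le_coe] at this
    omega
  exact le_antisymm (key h h') (key h' h)

/-- Apply `val_trace` with `y = Y`, so that `s = -b` and `c = 0`: traces raise the valuation bound
by `(N - 1) * b`. The bound at valuation `-d` is `1 - N`, which forces an integral trace. -/
lemma IsScaffold.isDifferentExponent (hS : IsScaffold vL p n b Y a c i₀) (hK : IsLocalField F vK)
    (hL : IsTotallyRamified vK vL) (hN : Module.finrank K L = p ^ n) (hpb : ¬ (p : ℤ) ∣ b) :
    IsDifferentExponent vK vL ((Module.finrank K L - 1) * (b + 1)) := by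
  have hcop : IsCoprime (-b) (Module.finrank K L : ℤ) := by
    rw [hN, Nat.cast_pow]
    exact ((Nat.prime_iff_prime_int.1 hp.out).coprime_iff_not_dvd.2 hpb).pow_left.symm.neg_left
  have hpos : (0 : ℤ) < Module.finrank K L := by exact_mod_cast Module.finrank_pos
  have htr := fun (x : L) (m : ℤ) (hx : (m : WithTop ℤ) ≤ vL x) =>
    val_trace hL hS.val hcop (fun σ hσ => hS.val_sub_eq_zero p hK hL hσ) hx
  intro x
  constructor
  · intro h
    by_contra hlt
    have hx0 : x ≠ 0 := by
      rintro rfl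
      simp at hlt
    obtain ⟨m, hm⟩ := exists_val_eq vL hx0
    rw [hm, WithTop.coe_le_coe, not_le] at hlt
    -- Choose `y` so that `x * y` has valuation `-d - 1`. This is congruent to `b`, so the trace has
    -- valuation exactly `-N` in `L` and is not integral.
    obtain ⟨y, hy⟩ := hL.normalized
      ((-((Module.finrank K L - 1) * (b + 1)) - 1 - m : ℤ) : WithTop ℤ)
    have hxy := val_mul_eq hm hy
    have h1 := h y (by rw [hy, ← WithTop.coe_zero, WithTop.coe_le_coe]; omega)
    have h2 := (htr _ _ hxy.ge).2 hxy
      (Int.modEq_iff_dvd.2 ⟨b + 1, by ring⟩)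
    have h3 := le_val_algebraMap hL (m := 0) h1
    rw [h2, WithTop.coe_le_coe] at h3
    linarith
  · intro hx y hy
    have hxy := le_val_mul (k := 0) hx hy
    refine le_val_of_le_val_algebraMap hL (m := 0) (coe_lt_of_le (htr _ _ hxy).1 ?_)
    linarith

lemma IsScaffold.isValuationCriterion_iff (hS : IsScaffold vL p n b Y a c i₀)
    (hK : IsLocalField F vK) (hL : IsTotallyRamified vK vL) (hN : Module.finrank K L = p ^ n)
    (hpb : ¬ (p : ℤ) ∣ b) (ρ : L) :
    IsValuationCriterion vK vL ρ ↔
      ∃ m : ℤ, vL ρ = (m : WithTop ℤ) ∧ m ≡ b [ZMOD (p ^ n : ℕ)] := by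
  have hd := hS.isDifferentExponent hK hL hN hpb
  have hmod : -((Module.finrank K L - 1) * (b + 1)) - 1 ≡ b [ZMOD (Module.finrank K L : ℤ)] :=
    Int.modEq_iff_dvd.2 ⟨b + 1, by ring⟩
  rw [← hN]
  constructor
  · rintro ⟨d, m, h1, h2, h3⟩
    rw [h1.unique hL hd] at h3
    exact ⟨m, h2, h3.trans hmod⟩
  · rintro ⟨m, h1, h2⟩
    exact ⟨_, m, hd, h1, h2.trans hmod.symm⟩

end Different

/-! ### Cosets and their valuations. -/

section Breaks

variable {F K L : Type*} [Field F] [Field K] [Field L] [Algebra F K] [Algebra K L]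
  [FiniteDimensional K L]

lemma coe_le_sub_coe {x : WithTop ℤ} {m S : ℤ} (h : ((m + S : ℤ) : WithTop ℤ) ≤ x) :
    (S : WithTop ℤ) ≤ x - (m : WithTop ℤ) := by
  induction x with
  | top => simp
  | coe r =>
    rw [WithTop.coe_le_coe] at h
    rw [← WithTop.LinearOrderedAddCommGroup.coe_sub, WithTop.coe_le_coe]
    omega

lemma coe_add_sub_coe (m S : ℤ) : ((m + S : ℤ) : WithTop ℤ) - (m : WithTop ℤ) = (S : WithTop ℤ) := by
  rw [← WithTop.LinearOrderedAddCommGroup.coe_sub, add_sub_cancel_left]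

/-- The trivial class therefore lies in every step of the filtration and creates no break, in
agreement with its exclusion from `rhoBreaks`. -/
lemma vHatBar_zero (vL : AddValuation L (WithTop ℤ)) (k : ℕ) :
    vHatBar vL (0 : QuotRing F K L k) = ⊤ := by
  have h1 : shiftSet vL (0 : GroupRing F K L) = {⊤} := by
    have h2 : ∀ x : L, shift vL (0 : GroupRing F K L) x = ⊤ := fun x => by
      rw [shift, act_eq_sum]
      simp
    ext s
    simp only [shiftSet, Set.mem_ofPred_eq, h2, Set.mem_singleton_iff]
    exact ⟨fun ⟨_, _, h⟩ => h, fun h => ⟨1, one_ne_zero, h⟩⟩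
  rw [eq_top_iff]
  refine le_csSup (OrderTop.bddAbove _) ⟨0, map_zero _, ?_⟩
  rw [vHat, h1, csInf_singleton]

end Breaks

end RefinedBreaks

end

/-! ### Proof of the main theorem. -/

open RefinedBreaks in
theorem mainTheorem2 {F K L : Type*} [Field F] [Field K] [Field L] [Algebra F K] [Algebra K L]
    [FiniteDimensional K L] [IsGalois K L]
    (p : ℕ) [Fact p.Prime] [CharP F p] [PerfectField F]
    (vK : AddValuation K (WithTop ℤ)) (vL : AddValuation L (WithTop ℤ))
    (hK : IsLocalField F vK) (hL : IsTotallyRamified vK vL)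
    (n : ℕ) (hG : Nonempty ((L ≃ₐ[K] L) ≃* Multiplicative (Fin n → ZMod p)))
    (b : ℤ) (hb : 0 < b) (hbreak : ramificationBreaks K vL = {b})
    (hAS : ∃ (β : K) (ω : Fin n → F) (ε : Fin n → K),
      IsArtinSchreierData L vK p n b β ω ε ∧
      ∀ i, ∀ m : ℤ, vK (ε i) = (m : WithTop ℤ) →
        -((b : ℚ) / (p : ℚ) ^ ((n : ℤ) - 2)) < (m : ℚ)) :
    (∀ ρ : L, IsValuationCriterion vK vL ρ →
      ∀ Υ : GroupRing F K L, Υ ∈ augIdeal F K L → Υ ∉ augIdeal F K L ^ 2 →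
        IsLeast (shiftSet vL Υ) (vHat vL Υ) ∧ vHat vL Υ = shift vL Υ ρ) ∧
    (∀ k : ℕ, 2 ≤ k → k ≤ p →
      VCBreaksDefined F K vK vL p k ∧
      vcBreaks F K vK vL p k = ssBreaks F K vL p k) := by
  have hp : Fact p.Prime := inferInstance
  have : CharP K p := charP_of_injective_algebraMap (algebraMap F K).injective p
  have : CharP L p := charP_of_injective_algebraMap (algebraMap K L).injective p
  have hcard : Nat.card (L ≃ₐ[K] L) = p ^ n := by
    rw [Nat.card_congr hG.some.toEquiv, Nat.card_congr Multiplicative.toAdd, Nat.card_fun]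
    simp
  have hN : Module.finrank K L = p ^ n := by rw [← hcard, IsGalois.card_aut_eq_finrank]
  obtain ⟨β, ω, ε, hdata, hε⟩ := hAS
  -- Multiplying the hypothesis by `p ^ n` turns it into a bound for the valuation of `L` that no
  -- longer depends on `n`; for `n = 1` the exponent `n - 2` is negative, hence the integer power.
  have hεL : ∀ i, ((-(b * p ^ 2) : ℤ) : WithTop ℤ) < vL (algebraMap K L (ε i)) := by
    intro i
    rcases eq_or_ne (ε i) 0 with h0 | h0
    · rw [h0, map_zero, vL.map_zero]; exact WithTop.coe_lt_top _
    · obtain ⟨m, hm⟩ := exists_val_eq vK h0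
      have h1 := hε i m hm
      rw [val_algebraMap hL hm, WithTop.coe_lt_coe, hN]
      have hp0 : (p : ℚ) ≠ 0 := by exact_mod_cast hp.out.ne_zero
      have hpn : (0 : ℚ) < (p : ℚ) ^ n := pow_pos (by exact_mod_cast hp.out.pos) n
      rw [zpow_sub₀ hp0, zpow_natCast] at h1
      have h2 := mul_lt_mul_of_pos_left h1 hpn
      have h3 : (p : ℚ) ^ n * -((b : ℚ) / ((p : ℚ) ^ n / (p : ℚ) ^ (2 : ℤ))) = -(b * p ^ 2) := by
        have : (p : ℚ) ^ (2 : ℤ) = (p : ℚ) ^ 2 := by norm_cast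
        rw [this]
        field_simp
      rw [h3] at h2
      exact_mod_cast h2
  obtain ⟨hpb, Y, a, c, i₀, hS⟩ := exists_scaffold p hK hL hcard hb hbreak hdata hεL
  have hcrit := hS.isValuationCriterion_iff hK hL hN hpb
  have key : ∀ Υ : GroupRing F K L, Υ ∈ augIdeal F K L → Υ ∉ augIdeal F K L ^ 2 →
      ∃ S : ℤ, 0 ≤ S ∧ S ≤ b * p ^ (n - 1) ∧ vHat vL Υ = (S : WithTop ℤ) ∧
        IsLeast (shiftSet vL Υ) (S : WithTop ℤ) ∧
        ∀ ρ (m : ℤ), IsValuationCriterion vK vL ρ → vL ρ = (m : WithTop ℤ) →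
          vL (act Υ ρ) = ((m + S : ℤ) : WithTop ℤ) := by
    intro Υ h1 h2
    have h0 : ∑ σ, Υ.coeff σ = 0 := by
      rw [mem_augIdeal_iff, pairing_apply] at h1
      simpa using h1
    -- If all sums `∑ Υ_σ * leadCoeff σ ^ p ^ j` vanished, `dual` would make every coordinate
    -- pairing of `Υ` vanish, which is excluded outside `A ^ 2`.
    obtain ⟨S, hS0, hSle, hge, heq⟩ := hS.exists_shift p hK hL hN hb hpb h0 (by
      by_contra hall
      push Not at hall
      obtain ⟨i, hi⟩ := exists_pairing_ne_zero hS.bijective hS.map_mul h1 h2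
      refine hi (congrFun (hS.dual
        (fun i => pairing (fun σ => ZMod.castHom (dvd_refl p) F (a σ i)) Υ) fun j hj => ?_) i)
      rw [← hall j hj]
      simp only [leadCoeff_pow, pairing_apply, Finset.mul_sum]
      rw [Finset.sum_comm]
      exact Finset.sum_congr rfl fun σ _ => Finset.sum_congr rfl fun i _ => by ring)
    have heq' : ∀ ρ (m : ℤ), IsValuationCriterion vK vL ρ → vL ρ = (m : WithTop ℤ) →
        vL (act Υ ρ) = ((m + S : ℤ) : WithTop ℤ) := by
      intro ρ m hρ hm
      obtain ⟨m', hm', hmod⟩ := (hcrit ρ).1 hρ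
      rw [hm, WithTop.coe_inj] at hm'
      subst hm'
      exact heq ρ m hm hmod
    have hleast : IsLeast (shiftSet vL Υ) (S : WithTop ℤ) := by
      constructor
      · obtain ⟨ρ, hρ⟩ := hL.normalized (b : WithTop ℤ)
        refine ⟨ρ, ne_zero_of_val hρ, ?_⟩
        rw [shift, heq ρ b hρ rfl, hρ, coe_add_sub_coe]
      · rintro _ ⟨x, hx, rfl⟩
        obtain ⟨m, hm⟩ := exists_val_eq vL hx
        rw [shift, hm]
        exact coe_le_sub_coe (hge x m hm.ge)
    exact ⟨S, hS0, hSle, hleast.csInf_eq, hleast, heq'⟩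
  refine ⟨fun ρ hρ Υ h1 h2 => ?_, fun k hk2 hk => ?_⟩
  · obtain ⟨S, -, -, hvHat, hleast, heq⟩ := key Υ h1 h2
    obtain ⟨m, hm, -⟩ := (hcrit ρ).1 hρ
    rw [hvHat]
    refine ⟨hleast, ?_⟩
    rw [shift, heq ρ m hρ hm, hm, coe_add_sub_coe]
  -- For each representative `γ` of `c`, the shift of `ρ` by `γ - 1` equals `vHat vL (γ - 1)`. These
  -- integers are at most `b * p ^ (n - 1)`, so the maximum `M` exists and serves both definitions.
  have hspan : ∀ c : QuotRing F K L k, GSpan p k c → c ≠ 1 → ∃ M : ℤ, 0 ≤ M ∧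
      vHatBar vL (c - 1) = (M : WithTop ℤ) ∧
      ∀ ρ, IsValuationCriterion vK vL ρ → iRho vL ρ c - vL ρ = (M : WithTop ℤ) := by
    intro c hc hc1
    have hmem := fun (γ : GroupRing F K L)
      (hγ : Ideal.Quotient.mk (augIdeal F K L ^ k) γ = c) =>
      hc.sub_one_mem hS.bijective hS.map_mul hk2 hk hc1 hγ
    obtain ⟨M, ⟨γ₀, hγ₀, hM⟩, hmax⟩ := Int.exists_greatest_of_bdd
      (P := fun s : ℤ => ∃ γ : GroupRing F K L,
        Ideal.Quotient.mk (augIdeal F K L ^ k) γ = c ∧ vHat vL (γ - 1) = (s : WithTop ℤ))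
      ⟨b * p ^ (n - 1), by
        rintro s ⟨γ, hγ, hs⟩
        obtain ⟨S, -, hSle, hvHat, -⟩ := key _ (hmem γ hγ).1 (hmem γ hγ).2
        rw [hs, WithTop.coe_inj] at hvHat
        omega⟩
      (by
        obtain ⟨γ, hγ⟩ := Ideal.Quotient.mk_surjective c
        obtain ⟨S, -, -, hvHat, -⟩ := key _ (hmem γ hγ).1 (hmem γ hγ).2
        exact ⟨S, γ, hγ, hvHat⟩)
    refine ⟨M, ?_, ?_, fun ρ hρ => ?_⟩
    · obtain ⟨S, hS0, -, hvHat, -⟩ := key _ (hmem γ₀ hγ₀).1 (hmem γ₀ hγ₀).2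
      rw [hM, WithTop.coe_inj] at hvHat
      omega
    · refine IsGreatest.csSup_eq ⟨⟨γ₀ - 1, ?_, hM.symm⟩, ?_⟩
      · rw [map_sub, hγ₀, map_one]
      · rintro _ ⟨γ, hγ, rfl⟩
        have hγ1 : Ideal.Quotient.mk (augIdeal F K L ^ k) (γ + 1) = c := by
          rw [map_add, hγ, map_one (Ideal.Quotient.mk (augIdeal F K L ^ k)), sub_add_cancel]
        obtain ⟨S, -, -, hvHat, -⟩ := key _ (hmem _ hγ1).1 (hmem _ hγ1).2
        have := hmax S ⟨γ + 1, hγ1, hvHat⟩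
        rw [add_sub_cancel_right] at hvHat
        rw [hvHat, WithTop.coe_le_coe]
        exact this
    · obtain ⟨m, hm, -⟩ := (hcrit ρ).1 hρ
      have hval : iRho vL ρ c = ((m + M : ℤ) : WithTop ℤ) := by
        refine IsGreatest.csSup_eq ⟨⟨γ₀, hγ₀, ?_⟩, ?_⟩
        · obtain ⟨S, -, -, hvHat, -, heq⟩ := key _ (hmem γ₀ hγ₀).1 (hmem γ₀ hγ₀).2
          rw [hM, WithTop.coe_inj] at hvHat
          rw [heq ρ m hρ hm, hvHat]
        · rintro _ ⟨γ, hγ, rfl⟩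
          obtain ⟨S, -, -, hvHat, -, heq⟩ := key _ (hmem γ hγ).1 (hmem γ hγ).2
          have := hmax S ⟨γ, hγ, hvHat⟩
          rw [heq ρ m hρ hm, WithTop.coe_le_coe]
          omega
      rw [hval, hm, coe_add_sub_coe]
  have hbreaks : ∀ ρ, IsValuationCriterion vK vL ρ → rhoBreaks F K vL p k ρ =
      {h | ∃ c : QuotRing F K L k, GSpan p k c ∧ c ≠ 1 ∧ h = vHatBar vL (c - 1)} := by
    intro ρ hρ
    ext h
    constructor
    · rintro ⟨c, hc, hc1, rfl⟩
      obtain ⟨M, -, h1, h2⟩ := hspan c hc hc1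
      exact ⟨c, hc, hc1, by rw [h1, h2 ρ hρ]⟩
    · rintro ⟨c, hc, hc1, rfl⟩
      obtain ⟨M, -, h1, h2⟩ := hspan c hc hc1
      exact ⟨c, hc, hc1, by rw [h1, h2 ρ hρ]⟩
  refine ⟨fun ρ ρ' hρ hρ' => by rw [hbreaks ρ hρ, hbreaks ρ' hρ'], ?_⟩
  ext s
  constructor
  · rintro ⟨ρ, hρ, hs⟩
    rw [hbreaks ρ hρ] at hs
    obtain ⟨c, hc, hc1, rfl⟩ := hs
    obtain ⟨M, hM0, h1, -⟩ := hspan c hc hc1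
    obtain ⟨h, rfl⟩ := Int.eq_ofNat_of_zero_le hM0
    -- The class `c` itself lies in the filtration at level `h = M` and not at level `h + 1`.
    refine ⟨h, h1, fun heq => ?_⟩
    have hmem : c ∈ spanFiltration F K vL p k h := ⟨hc, h1.ge⟩
    rw [← heq] at hmem
    have h2 := hmem.2
    rw [h1, WithTop.coe_le_coe] at h2
    push_cast at h2
    omega
  · rintro ⟨h, rfl, hne⟩
    have hsub : spanFiltration F K vL p k (h + 1) ⊆ spanFiltration F K vL p k h := by
      rintro c ⟨hc, hc'⟩
      exact ⟨hc, coe_le_of_le hc' (by push_cast; omega)⟩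
    -- A class lost between levels `h` and `h + 1` is nontrivial and has maximal shift exactly `h`.
    obtain ⟨c, ⟨hc, hch⟩, hcn⟩ := Set.exists_of_ssubset (lt_of_le_of_ne hsub hne)
    have hc1 : c ≠ 1 := by
      rintro rfl
      refine hcn ⟨hc, ?_⟩
      rw [sub_self, vHatBar_zero]
      exact le_top
    obtain ⟨M, hM0, h1, -⟩ := hspan c hc hc1
    have hMh : M = h := by
      rw [h1, WithTop.coe_le_coe] at hch
      have h2 : ¬ (((h + 1 : ℕ) : ℤ) : WithTop ℤ) ≤ vHatBar vL (c - 1) := fun h => hcn ⟨hc, h⟩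
      rw [h1, WithTop.coe_le_coe] at h2
      push_cast at h2
      omega
    obtain ⟨ρ, hρ⟩ := hL.normalized (b : WithTop ℤ)
    have hρ' : IsValuationCriterion vK vL ρ := (hcrit ρ).2 ⟨b, hρ, rfl⟩
    refine ⟨ρ, hρ', ?_⟩
    rw [hbreaks ρ hρ']
    exact ⟨c, hc, hc1, by rw [h1, hMh]⟩
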